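/- Let $\mathbb N=\{1,2,3,\dots\}$, let $l^\infty$ be the space of bounded real functions on $\mathbb N$, and let $L^\infty$ be the space of essentially bounded measurable real functions on $[1,\infty)$ (Lebesgue measure). Let $\mathcal C$ be the set of all linear functionals $\varphi$ on $l^\infty$ with $\varphi(f)\le\limsup_{n\to\infty}\frac1n\sum_{i=1}^n f(i)$ for all $f\in l^\infty$, and let $\mathcal M$ be the set of all linear functionals $\psi$ on $L^\infty$ with $\psi(f)\le\limsup_{x\to\infty}\frac1x\int_1^x f(t)\,dt$ for all $f\in L^\infty$; both sets carry the weak* topology. Let $\beta\mathbb N$ be the space of ultrafilters on $\mathbb N$, $\tau:\beta\mathbb N\to\beta\mathbb N$ the continuous extension of $n\mapsto n+1$, and $\mathbb N^*=\beta\mathbb N\setminus\mathbb N$ the set of free ultrafilters. Let $\Omega$ be the quotient of $\beta\mathbb N\times[0,1]$ obtained by identifying $(\eta,1)$ with $(\tau\eta,0)$ for all $\eta\in\beta\mathbb N$, and let $\Omega^*\subset\Omega$ be the subspace of the points $(\eta,t)$ with $\eta\in\mathbb N^*$. For $\omega=(\eta,t)\in\Omega^*$ and $\theta=2^t$ put $$\varphi_\omega(f)=\eta\text{-}\lim_n\frac1{\theta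 2^n}\sum_{i=1}^{\lfloor\theta 2^n\rfloor}f(i)\quad(f\in l^\infty),\qquad \psi_\omega(f)=\eta\text{-}\lim_n\frac1{\theta 2^n}\int_1^{\theta 2^n}f(t)\,dt\quad(f\in L^\infty).$$ These do not depend on the choice of the representative $(\eta,t)$ of $\omega$. Let $P(\Omega^*)$ be the set of regular Borel probability measures on $\Omega^*$ with the topology of weak convergence (integration against continuous functions). Then the following hold. (0) For every $f\in l^\infty$ the function $\omega\mapsto\varphi_\omega(f)$, and for every $f\in L^\infty$ the function $\omega\mapsto\psi_\omega(f)$, is continuous on $\Omega^*$. (1) For every $\varphi\in\mathcal C$ there is a unique $\mu\in P(\Omega^*)$ such that $\varphi(f)=\int_{\Omega^*}\varphi_\omega(f)\,d\mu(\omega)$ for all $f\in l^\infty$. (2) For every $\psi\in\mathcal M$ there is a unique $\mu\in P(\Omega^*)$ such that $\psi(f)=\int_{\Omega^*}\psi_\omega(f)\,d\mu(\omega)$ for all $f\in L^\infty$. (3) The map that sends $\mu$ to $f\mapsto\int_{\Omega^*}\varphi_\omega(f)\,d\mu(\omega)$ is an affine homeomorphism of $P(\Omega^*)$ onto $\mathcal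 C$, and the map that sends $\mu$ to $f\mapsto\int_{\Omega^*}\psi_\omega(f)\,d\mu(\omega)$ is an affine homeomorphism of $P(\Omega^*)$ onto $\mathcal M$. (4) $\mathcal C$ is a Bauer simplex: it is a nonempty compact convex set, the linear span of the cone $\{(r\varphi,r):r\ge0,\ \varphi\in\mathcal C\}\subset(l^\infty)^*\times\mathbb R$ is a vector lattice in the order whose positive cone is this cone, and the set of extreme points of $\mathcal C$ is closed. -/

import Mathlib

open MeasureTheory Filter Topology Set
open scoped ENNReal NNReal

noncomputable section

namespace CesaroBauer

/-! ### The two function spaces and the two classes of functionals -/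

/-- `l^∞`: bounded real functions on the positive integers. -/
abbrev LInf : Type := lp (fun _ : ℕ+ => ℝ) ∞

/-- `L^∞([1, ∞))` with respect to Lebesgue measure. -/
abbrev LInfR : Type := Lp ℝ ∞ (volume.restrict (Ici (1 : ℝ)))

/-- The average `(1/x) ∑_{1 ≤ i ≤ ⌊x⌋} f(i)`. The summation variable is shifted by one:
`i.succPNat` is the positive integer `i + 1`. -/
def sumMean (f : LInf) (x : ℝ) : ℝ :=
  (1 / x) * ∑ i ∈ Finset.range ⌊x⌋₊, f i.succPNat

/-- The average `(1/x) ∫_1^x f(t) dt`. -/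
def intMean (f : LInfR) (x : ℝ) : ℝ :=
  (1 / x) * ∫ t in (1 : ℝ)..x, f t

/-- The upper Cesàro mean of a bounded sequence. -/
def upperCesaro (f : LInf) : ℝ := limsup (fun n : ℕ => sumMean f n) atTop

/-- The upper mean of an essentially bounded function on `[1, ∞)`. -/
def upperMean (f : LInfR) : ℝ := limsup (fun x : ℝ => intMean f x) atTop

/-- The defining condition of the class `𝒞`, for an arbitrary linear functional. -/
def IsCesaroFunctional (φ : LInf →ₗ[ℝ] ℝ) : Prop := ∀ f, φ f ≤ upperCesaro f

/-- The defining condition of the class `ℳ`, for an arbitrary linear functional. -/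
def IsMeanFunctional (ψ : LInfR →ₗ[ℝ] ℝ) : Prop := ∀ f, ψ f ≤ upperMean f

/-- `𝒞` as a subset of the dual of `l^∞` with its weak-* topology. (The continuity that
membership in the dual requires is automatic for functionals satisfying the condition.) -/
def classC : Set (WeakDual ℝ LInf) := {φ | ∀ f, φ f ≤ upperCesaro f}

/-- `ℳ` as a subset of the dual of `L^∞([1, ∞))` with its weak-* topology. -/
def classM : Set (WeakDual ℝ LInfR) := {ψ | ∀ f, ψ f ≤ upperMean f}

/-! ### The suspension space -/

/-- The limit of `g` along an ultrafilter (it exists whenever `g` is bounded). -/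
def ulim {X : Type*} (U : Ultrafilter X) (g : X → ℝ) : ℝ := limUnder (U : Filter X) g

/-- The extension to `βℕ` (the space of ultrafilters) of the shift `n ↦ n + 1`. -/
def shift (η : Ultrafilter ℕ+) : Ultrafilter ℕ+ := η.map (fun n => n + 1)

/-- `ℕ* = βℕ ∖ ℕ`, the free ultrafilters. -/
def freeUltrafilters : Set (Ultrafilter ℕ+) := {η | ∀ n : ℕ+, η ≠ pure n}

/-- The gluing of `(η, 1)` to `(τ η, 0)`. -/
def glue (p q : Ultrafilter ℕ+ × unitInterval) : Prop :=
  p.2 = 1 ∧ q.2 = 0 ∧ q.1 = shift p.1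

/-- `Ω`: the quotient of `βℕ × [0,1]` by the equivalence relation generated by `glue`. -/
def Omega : Type := Quot glue

/-- The quotient topology. -/
instance : TopologicalSpace Omega := inferInstanceAs (TopologicalSpace (Quot glue))

/-- The Borel σ-algebra. -/
instance : MeasurableSpace Omega := borel Omega

instance : BorelSpace Omega := ⟨rfl⟩

/-- `Ω*`: the points `(η, t)` of `Ω` with `η` free. -/
def OmegaStar : Set Omega := {ω | ∃ η ∈ freeUltrafilters, ∃ t, ω = Quot.mk glue (η, t)}

/-- For `ω = (η, t)` and `θ = 2 ^ t`, the limit `η-lim_n F (θ * 2 ^ n)`. It takes the same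
value at `(η, 1)` and at `(τ η, 0)`, so that it is a function of `ω`. -/
def limAt (F : ℝ → ℝ) : Omega → ℝ :=
  Quot.lift (fun p => ulim p.1 (fun n : ℕ+ => F ((2 : ℝ) ^ (p.2 : ℝ) * (2 : ℝ) ^ (n : ℕ)))) (by
    rintro ⟨η, s⟩ ⟨η', s'⟩ ⟨h1, h2, h3⟩
    simp only at h1 h2 h3
    subst h1 h2 h3
    simp only [ulim, limUnder, shift, Ultrafilter.coe_map, Filter.map_map]
    congr 2
    funext n
    simp [pow_succ, mul_comm])

/-- `φ_ω(f) = η-lim_n (1/(θ 2^n)) ∑_{i=1}^{⌊θ 2^n⌋} f(i)`, where `ω = (η, t)`, `θ = 2 ^ t`. -/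
def phi (ω : OmegaStar) (f : LInf) : ℝ := limAt (sumMean f) ω

/-- `ψ_ω(f) = η-lim_n (1/(θ 2^n)) ∫_1^{θ 2^n} f(t) dt`, where `ω = (η, t)`, `θ = 2 ^ t`. -/
def psi (ω : OmegaStar) (f : LInfR) : ℝ := limAt (intMean f) ω

/-! ### Regular Borel probability measures -/

/-- The regular Borel probability measures on a topological space, with the topology of
weak convergence (integration against bounded continuous functions). -/
abbrev RegProb (X : Type*) [TopologicalSpace X] [MeasurableSpace X] : Type _ :=
  {μ : ProbabilityMeasure X // (μ : Measure X).Regular}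

/-- The measure underlying an element of `RegProb X`. -/
abbrev RegProb.meas {X : Type*} [TopologicalSpace X] [MeasurableSpace X] (μ : RegProb X) :
    Measure X := (μ.1 : Measure X)

/-- The sum of two finite regular measures is regular. -/
theorem regular_add {X : Type*} [TopologicalSpace X] [MeasurableSpace X] [BorelSpace X]
    (μ ν : Measure X) [IsFiniteMeasure μ] [IsFiniteMeasure ν] [μ.Regular] [ν.Regular] :
    (μ + ν).Regular := by
  have h1 : (μ + ν).OuterRegular := by
    refine ⟨fun A hA r hr => ?_⟩
    obtain ⟨δ, hδ, hr'⟩ : ∃ δ > 0, (μ + ν) A + δ < r := by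
      obtain ⟨c, hc1, hc2⟩ := exists_between hr
      exact ⟨c - (μ + ν) A, tsub_pos_of_lt hc1, by rwa [add_tsub_cancel_of_le hc1.le]⟩
    have hδ2 : δ / 2 ≠ 0 := (ENNReal.half_pos hδ.ne').ne'
    obtain ⟨U, hAU, hU, hμU⟩ := A.exists_isOpen_le_add μ hδ2
    obtain ⟨V, hAV, hV, hνV⟩ := A.exists_isOpen_le_add ν hδ2
    refine ⟨U ∩ V, subset_inter hAU hAV, hU.inter hV, lt_of_le_of_lt ?_ hr'⟩
    calc (μ + ν) (U ∩ V) ≤ μ U + ν V :=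
          add_le_add (measure_mono inter_subset_left) (measure_mono inter_subset_right)
      _ ≤ (μ A + δ / 2) + (ν A + δ / 2) := add_le_add hμU hνV
      _ = (μ + ν) A + δ := by
          rw [Measure.add_apply, add_add_add_comm, ENNReal.add_halves]
  refine { toOuterRegular := h1, innerRegular := ?_ }
  intro U hU r hr
  simp only [Measure.coe_add, Pi.add_apply] at hr ⊢
  rcases eq_or_ne (μ U) 0 with h | h
  · simp only [h, zero_add] at hr
    rcases hU.exists_lt_isCompact hr with ⟨K, Ks, hK, hlt⟩
    exact ⟨K, Ks, hK, hlt.trans_le (by simp)⟩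
  rcases eq_or_ne (ν U) 0 with h' | h'
  · simp only [h', add_zero] at hr
    rcases hU.exists_lt_isCompact hr with ⟨K, Ks, hK, hlt⟩
    exact ⟨K, Ks, hK, hlt.trans_le (by simp)⟩
  rcases ENNReal.exists_lt_add_of_lt_add hr h h' with ⟨u, hu, v, hv, huv⟩
  rcases hU.exists_lt_isCompact hu with ⟨K, Ks, hK, hKlt⟩
  rcases hU.exists_lt_isCompact hv with ⟨L, Ls, hL, hLlt⟩
  exact ⟨K ∪ L, union_subset Ks Ls, hK.union hL, huv.trans_le ((add_le_add hKlt.le hLlt.le).trans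
    (add_le_add (measure_mono subset_union_left) (measure_mono subset_union_right)))⟩

/-- The convex combination `a μ + b ν`. -/
def RegProb.mix {X : Type*} [TopologicalSpace X] [MeasurableSpace X] [BorelSpace X]
    (a b : ℝ≥0) (h : a + b = 1) (μ ν : RegProb X) : RegProb X :=
  ⟨⟨a • μ.meas + b • ν.meas, ⟨by
      simp only [Measure.add_apply, Measure.smul_apply, measure_univ]
      simp only [ENNReal.smul_def, smul_eq_mul, mul_one]
      exact_mod_cast h⟩⟩, by
    have := μ.2
    have := ν.2
    exact regular_add (a • μ.meas) (b • ν.meas)⟩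

/-! ### Bauer simplices -/

section Simplex

variable {E : Type*} [AddCommGroup E] [Module ℝ E]

/-- The cone over `K`, that is, the cone generated by the copy `K × {1}` of `K`, which lies in
a hyperplane that misses the origin. -/
def coneOver (K : Set E) : Set (E × ℝ) := {p | ∃ r : ℝ, 0 ≤ r ∧ ∃ x ∈ K, p = (r • x, r)}

/-- Choquet simplices: nonempty compact convex sets `K` such that the linear span of the cone
over `K` is a vector lattice in the order `u ≤ v ↔ v - u ∈ coneOver K`: any two elements have
a least upper bound (and hence, by `u ↦ -u`, a greatest lower bound). -/
def IsChoquetSimplex [TopologicalSpace E] (K : Set E) : Prop :=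
  K.Nonempty ∧ IsCompact K ∧ Convex ℝ K ∧
    ∀ u ∈ Submodule.span ℝ (coneOver K), ∀ v ∈ Submodule.span ℝ (coneOver K),
      ∃ w ∈ Submodule.span ℝ (coneOver K), w - u ∈ coneOver K ∧ w - v ∈ coneOver K ∧
        ∀ z ∈ Submodule.span ℝ (coneOver K),
          z - u ∈ coneOver K → z - v ∈ coneOver K → z - w ∈ coneOver K

/-- Bauer simplices: Choquet simplices whose set of extreme points is closed. -/
def IsBauerSimplex [TopologicalSpace E] (K : Set E) : Prop :=
  IsChoquetSimplex K ∧ IsClosed (K.extremePoints ℝ)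

end Simplex

end CesaroBauer

end

/-!
A function `F` on `[1, ∞)` varies slowly if it is bounded and `|F y - F x| = O((y - x + 1) / y)`
for `x ≤ y`. The means `x ↦ (1/x) ∑_{i ≤ x} f(i)` and `x ↦ (1/x) ∫_1^x f` vary slowly, and
conversely every slowly varying `F` is such a mean up to a function that tends to `0`
(`exists_tendsto_sumMean_sub`, `exists_tendsto_intMean_sub`): the sequence
`f(n) = n F(n) - (n - 1) F(n - 1)` is bounded and its partial sums telescope to `N F(N)`.

The space `Ω*` consists of the directions in which `x = 2 ^ (n + t)` tends to infinity: each point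
is given by an ultrafilter on `ℝ` tending to infinity, and each such ultrafilter has a limit in
`Ω*` (`exists_tendsto_limAt_of_ultrafilter`). So a slowly varying `F` extends continuously to `Ω*`,
and the upper limit of `F` is the maximum of the extension. The extensions form an algebra that
separates the points of `Ω*` (`exists_limAt_ne`). Hence `Ω*`, which is compact, is a Hausdorff
space, and by the Stone–Weierstrass theorem the algebra is dense in `C(Ω*)`
(`dense_limAlgebra`).

Therefore both `f ↦ (ω ↦ φ_ω(f))` and `f ↦ (ω ↦ ψ_ω(f))` are operators `T : E → C(X)`, `X = Ω*`,
with dense range, and the two classes consist of the functionals that are dominated by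
`p f = max (T f)`. For all such `T` a dominated functional is `Λ ∘ T` for a unique state `Λ` of
`C(X)` (`exists_extension_of_dominated`), and the states are the regular probability measures, by
the Riesz representation theorem. The topologies agree because integrals of arbitrary continuous
functions are uniform limits of integrals of functions `T f` (`homeoDominated`). The lattice
operations come from the lattice of finite measures (`span_coneOver_sup`), and the extreme states
are multiplicative, hence the evaluations at the points of the compact space `X`
(`extremePoints_dominated`), which form a closed set.
-/

noncomputable section

namespace CesaroBauer

/-! ### States of `C(X)` -/

section States

variable {X : Type*} [TopologicalSpace X]

/-- The states of `C(X)` are described by the condition that `g ≤ c` implies `Λ g ≤ c`; they are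
positive. -/
theorem nonneg_of_le_max {Λ : C(X, ℝ) →L[ℝ] ℝ} (hΛ : ∀ g c, (∀ x, g x ≤ c) → Λ g ≤ c)
    {g : C(X, ℝ)} (hg : ∀ x, 0 ≤ g x) : 0 ≤ Λ g := by
  have := hΛ (-g) 0 fun x => by simpa using hg x
  simpa using this

theorem apply_one_of_le_max {Λ : C(X, ℝ) →L[ℝ] ℝ} (hΛ : ∀ g c, (∀ x, g x ≤ c) → Λ g ≤ c) :
    Λ 1 = 1 := by
  refine le_antisymm (hΛ 1 1 fun x => by simp) ?_
  have := hΛ (-1) (-1) fun x => by simp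
  rw [map_neg] at this
  linarith

/-- Evaluation at a point, as a functional on `C(X)`. -/
abbrev evalAt (x : X) : C(X, ℝ) →L[ℝ] ℝ := ContinuousMap.evalCLM ℝ x

/-- A state that kills the nonnegative functions vanishing at `x` is the evaluation at `x`:
it kills `|g - g x|`. -/
theorem eq_evalAt_of_forall {Λ : C(X, ℝ) →L[ℝ] ℝ} (hΛ : ∀ g c, (∀ x, g x ≤ c) → Λ g ≤ c)
    {x : X} (h : ∀ g : C(X, ℝ), (∀ y, 0 ≤ g y) → g x = 0 → Λ g = 0) : Λ = evalAt x := by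
  ext g
  have h1 : ∀ g : C(X, ℝ), Λ g ≤ g x := fun g => by
    have h0 := h |g - ContinuousMap.const X (g x)| (fun y => by simp) (by simp)
    have h2 := nonneg_of_le_max hΛ
      (g := |g - ContinuousMap.const X (g x)| - (g - ContinuousMap.const X (g x)))
      (fun y => by simpa using le_abs_self (g y - g x))
    have h3 : ContinuousMap.const X (g x) = g x • (1 : C(X, ℝ)) := by ext; simp
    rw [map_sub, h0, map_sub, h3, map_smul, apply_one_of_le_max hΛ, smul_eq_mul, mul_one] at h2
    linarith
  have h2 := h1 (-g)
  rw [map_neg] at h2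
  exact le_antisymm (h1 g) (by simpa using h2)

end States

/-! ### Regular measures and the Riesz representation theorem -/

section Integration

variable {X : Type*} [TopologicalSpace X] [CompactSpace X] [MeasurableSpace X] [BorelSpace X]

theorem integrable_continuousMap (μ : Measure X) [IsFiniteMeasure μ] (g : C(X, ℝ)) :
    Integrable (fun x => g x) μ :=
  (BoundedContinuousFunction.mkOfCompact g).integrable μ

/-- Integration against a finite measure as a bounded functional on `C(X)`. -/
def integralC (μ : Measure X) [IsFiniteMeasure μ] : C(X, ℝ) →L[ℝ] ℝ :=
  LinearMap.mkContinuous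
    { toFun := fun g => ∫ x, g x ∂μ
      map_add' := fun g h => by
        simpa using integral_add (integrable_continuousMap μ g) (integrable_continuousMap μ h)
      map_smul' := fun c g => by simpa using integral_const_mul c (fun x => g x) }
    (μ.real univ) (fun g => by
      rw [mul_comm]
      exact norm_integral_le_of_norm_le_const (ae_of_all _ fun x => g.norm_coe_le_norm x))

theorem integralC_apply (μ : Measure X) [IsFiniteMeasure μ] (g : C(X, ℝ)) :
    integralC μ g = ∫ x, g x ∂μ := rfl

theorem integralC_add (μ ν : Measure X) [IsFiniteMeasure μ] [IsFiniteMeasure ν] :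
    integralC (μ + ν) = integralC μ + integralC ν := by
  ext g
  exact integral_add_measure (integrable_continuousMap μ g) (integrable_continuousMap ν g)

theorem integralC_le (μ : Measure X) [IsProbabilityMeasure μ] {g : C(X, ℝ)} {c : ℝ}
    (h : ∀ x, g x ≤ c) : integralC μ g ≤ c := by
  have := integral_mono (integrable_continuousMap μ g) (integrable_const c) h
  simpa [integralC_apply] using this

theorem integralC_mix (a b : ℝ≥0) (h : a + b = 1) (μ ν : RegProb X) :
    integralC (RegProb.mix a b h μ ν).meas
      = (a : ℝ) • integralC μ.meas + (b : ℝ) • integralC ν.meas := by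
  ext g
  have h1 := integral_add_measure (μ := a • μ.meas) (ν := b • ν.meas) (f := fun x => g x)
    (integrable_continuousMap _ g) (integrable_continuousMap _ g)
  rw [integral_smul_nnreal_measure, integral_smul_nnreal_measure] at h1
  exact h1

variable [T2Space X]

theorem integralC_injective {μ ν : Measure X} [IsFiniteMeasure μ] [IsFiniteMeasure ν]
    [μ.Regular] [ν.Regular] (h : integralC μ = integralC ν) : μ = ν :=
  Measure.ext_of_integral_eq_on_compactlySupported fun f =>
    congrArg (fun Λ : C(X, ℝ) →L[ℝ] ℝ => Λ f.toContinuousMap) h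

/-- The Riesz representation theorem for `C(X)` with `X` compact. -/
theorem exists_regular_integralC_eq (Λ : C(X, ℝ) →L[ℝ] ℝ) (hΛ : ∀ g, (∀ x, 0 ≤ g x) → 0 ≤ Λ g) :
    ∃ μ : Measure X, ∃ _ : IsFiniteMeasure μ, μ.Regular ∧ integralC μ = Λ := by
  let e : CompactlySupportedContinuousMap X ℝ →ₗ[ℝ] ℝ :=
    { toFun := fun g => Λ g.toContinuousMap
      map_add' := fun g h => Λ.map_add g.toContinuousMap h.toContinuousMap
      map_smul' := fun c g => Λ.map_smul c g.toContinuousMap }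
  let P := PositiveLinearMap.mk₀ e fun g hg => hΛ g.toContinuousMap hg
  refine ⟨RealRMK.rieszMeasure P, inferInstance, inferInstance, ?_⟩
  ext g
  exact RealRMK.integral_rieszMeasure P (CompactlySupportedContinuousMap.continuousMapEquiv g)

/-- A functional on `C(X)` that is dominated by the maximum is given by a regular
probability measure. -/
theorem exists_regProb_integralC_eq (Λ : C(X, ℝ) →L[ℝ] ℝ)
    (hΛ : ∀ g c, (∀ x, g x ≤ c) → Λ g ≤ c) : ∃ μ : RegProb X, integralC μ.meas = Λ := by
  obtain ⟨μ, hfin, hreg, hμ⟩ := exists_regular_integralC_eq Λ fun g hg =>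
    nonneg_of_le_max hΛ hg
  have h1 := apply_one_of_le_max hΛ
  rw [← hμ] at h1
  change ∫ x, (1 : C(X, ℝ)) x ∂μ = 1 at h1
  simp only [ContinuousMap.one_apply, integral_const, smul_eq_mul, mul_one] at h1
  refine ⟨⟨⟨μ, ⟨?_⟩⟩, hreg⟩, hμ⟩
  rw [← ENNReal.toReal_eq_one_iff]
  exact h1

theorem regProb_ext {μ ν : RegProb X} (h : integralC μ.meas = integralC ν.meas) : μ = ν := by
  have := μ.2
  have := ν.2
  have h1 : μ.meas = ν.meas := integralC_injective h
  exact Subtype.ext (Subtype.ext h1)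

end Integration

/-! ### Functionals dominated by the maximum of `T f` -/

section Domination

variable {X : Type*} [TopologicalSpace X]
  {E : Type*} [NormedAddCommGroup E] [NormedSpace ℝ E]

/-- The functionals dominated by `p`, with the weak-* topology. -/
def dominated (p : E → ℝ) : Set (WeakDual ℝ E) := {φ | ∀ f, φ f ≤ p f}

/-- The restriction of a functional on `C(X)` along `T : E → C(X)`. -/
def pullback (T : E →L[ℝ] C(X, ℝ)) (Λ : C(X, ℝ) →L[ℝ] ℝ) : WeakDual ℝ E :=
  StrongDual.toWeakDual (Λ.comp T)

theorem pullback_injective {T : E →L[ℝ] C(X, ℝ)} (hT : DenseRange T) :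
    Function.Injective (pullback T) := fun Λ Λ' h => by
  have h1 : (fun g => Λ g) = fun g => Λ' g :=
    hT.equalizer Λ.continuous Λ'.continuous
      (funext fun f => congrArg (fun φ : WeakDual ℝ E => φ f) h)
  ext g
  exact congrFun h1 g

theorem pullback_mem_dominated {T : E →L[ℝ] C(X, ℝ)} {p : E → ℝ}
    (hp : ∀ f c, p f ≤ c ↔ ∀ x, T f x ≤ c)
    {Λ : C(X, ℝ) →L[ℝ] ℝ} (hΛ : ∀ g c, (∀ x, g x ≤ c) → Λ g ≤ c) :
    pullback T Λ ∈ dominated p := fun f => hΛ _ _ ((hp f _).1 le_rfl)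

theorem convex_dominated (p : E → ℝ) : Convex ℝ (dominated p) := by
  intro φ hφ ψ hψ a b ha hb hab f
  have h1 := mul_le_mul_of_nonneg_left (hφ f) ha
  have h2 := mul_le_mul_of_nonneg_left (hψ f) hb
  calc a * φ f + b * ψ f ≤ a * p f + b * p f := add_le_add h1 h2
    _ = p f := by rw [← add_mul, hab, one_mul]

theorem continuous_pullback_evalAt (T : E →L[ℝ] C(X, ℝ)) :
    Continuous fun x : X => pullback T (evalAt x) :=
  WeakDual.continuous_of_continuous_eval fun f => (T f).continuous

variable [CompactSpace X] {T : E →L[ℝ] C(X, ℝ)} {p : E → ℝ}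

theorem abs_le_of_dominated (hp : ∀ f c, p f ≤ c ↔ ∀ x, T f x ≤ c) (φ : E →ₗ[ℝ] ℝ)
    (hφ : ∀ f, φ f ≤ p f) (f : E) : |φ f| ≤ ‖T f‖ := by
  have key : ∀ f, φ f ≤ ‖T f‖ := fun f => (hφ f).trans <|
    (hp f _).2 fun x => (le_abs_self _).trans ((T f).norm_coe_le_norm x)
  refine abs_le.2 ⟨?_, key f⟩
  have := key (-f)
  rw [map_neg, map_neg, norm_neg] at this
  linarith

/-- A dominated functional factors through `T`, with a factor dominated by the maximum. -/
theorem exists_extension_of_dominated (hT : DenseRange T)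
    (hp : ∀ f c, p f ≤ c ↔ ∀ x, T f x ≤ c) (φ : E →ₗ[ℝ] ℝ) (hφ : ∀ f, φ f ≤ p f) :
    ∃ Λ : C(X, ℝ) →L[ℝ] ℝ, (∀ f, Λ (T f) = φ f) ∧ ∀ g c, (∀ x, g x ≤ c) → Λ g ≤ c := by
  have hb : ∀ f, ‖φ f‖ ≤ 1 * ‖T.toLinearMap f‖ := fun f => by
    rw [one_mul]
    exact abs_le_of_dominated hp φ hφ f
  have hd : DenseRange T.toLinearMap := hT
  refine ⟨φ.extendOfNorm T.toLinearMap, fun f => LinearMap.extendOfNorm_eq hd ⟨1, hb⟩ f, ?_⟩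
  intro g c hg
  refine le_of_forall_pos_le_add fun ε hε => ?_
  obtain ⟨f, hf⟩ := hT.exists_dist_lt g (half_pos hε)
  rw [dist_eq_norm] at hf
  have h1 : φ f ≤ c + ε / 2 := (hφ f).trans <| (hp f _).2 fun x => by
    have h2 := (abs_le.1 ((g - T f).norm_coe_le_norm x)).1
    have h3 := hg x
    simp only [ContinuousMap.sub_apply] at h2
    linarith
  have h2 := LinearMap.norm_extendOfNorm_apply_le hd 1 hb (g - T f)
  rw [map_sub, one_mul] at h2
  have h3 := (abs_le.1 h2).2
  have h4 : φ.extendOfNorm T.toLinearMap (T f) = φ f := LinearMap.extendOfNorm_eq hd ⟨1, hb⟩ f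
  rw [h4] at h3
  linarith

theorem exists_pullback_eq_of_mem_dominated (hT : DenseRange T)
    (hp : ∀ f c, p f ≤ c ↔ ∀ x, T f x ≤ c) {φ : WeakDual ℝ E} (hφ : φ ∈ dominated p) :
    ∃ Λ : C(X, ℝ) →L[ℝ] ℝ, pullback T Λ = φ ∧ ∀ g c, (∀ x, g x ≤ c) → Λ g ≤ c := by
  obtain ⟨Λ, h1, h2⟩ := exists_extension_of_dominated hT hp (WeakDual.toStrongDual φ).toLinearMap hφ
  exact ⟨Λ, DFunLike.ext _ _ h1, h2⟩

theorem isCompact_dominated (hp : ∀ f c, p f ≤ c ↔ ∀ x, T f x ≤ c) :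
    IsCompact (dominated p) := by
  refine WeakDual.isCompact_of_bounded_of_closed ?_ ?_
  · refine (WeakDual.isBounded_closedBall (0 : StrongDual ℝ E) ‖T‖).subset fun φ hφ => ?_
    simp only [mem_preimage, Metric.mem_closedBall, dist_zero_right]
    refine ContinuousLinearMap.opNorm_le_bound _ T.opNorm_nonneg fun f => ?_
    exact (abs_le_of_dominated hp (WeakDual.toStrongDual φ).toLinearMap hφ f).trans
      (T.le_opNorm f)
  · simp only [dominated, Set.ofPred_forall]
    exact isClosed_iInter fun f => isClosed_le (WeakDual.eval_continuous f) continuous_const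

end Domination

/-! ### The homeomorphism with the regular probability measures -/

section Representation

variable {X : Type*} [TopologicalSpace X] [CompactSpace X] [T2Space X] [MeasurableSpace X]
  [BorelSpace X] {E : Type*} [NormedAddCommGroup E] [NormedSpace ℝ E]
  {T : E →L[ℝ] C(X, ℝ)} {p : E → ℝ}

theorem existsUnique_regProb (hT : DenseRange T) (hp : ∀ f c, p f ≤ c ↔ ∀ x, T f x ≤ c)
    (φ : E →ₗ[ℝ] ℝ) (hφ : ∀ f, φ f ≤ p f) :
    ∃! μ : RegProb X, ∀ f, φ f = ∫ x, T f x ∂μ.meas := by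
  obtain ⟨Λ, h1, h2⟩ := exists_extension_of_dominated hT hp φ hφ
  obtain ⟨μ, rfl⟩ := exists_regProb_integralC_eq Λ h2
  refine ⟨μ, fun f => (h1 f).symm, fun ν hν => regProb_ext (pullback_injective hT ?_)⟩
  exact DFunLike.ext _ _ fun f => (hν f).symm.trans (h1 f).symm

/-- The map `μ ↦ (f ↦ ∫ T f dμ)` from regular probability measures to dominated functionals. -/
def toDominated (hp : ∀ f c, p f ≤ c ↔ ∀ x, T f x ≤ c) (μ : RegProb X) : dominated p :=
  ⟨pullback T (integralC μ.meas), pullback_mem_dominated hp fun _ _ h => integralC_le _ h⟩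

theorem toDominated_bijective (hT : DenseRange T) (hp : ∀ f c, p f ≤ c ↔ ∀ x, T f x ≤ c) :
    Function.Bijective (toDominated hp : RegProb X → dominated p) := by
  refine ⟨fun μ ν h => regProb_ext (pullback_injective hT (congrArg Subtype.val h)), ?_⟩
  rintro ⟨φ, hφ⟩
  obtain ⟨Λ, rfl, h2⟩ := exists_pullback_eq_of_mem_dominated hT hp hφ
  obtain ⟨μ, rfl⟩ := exists_regProb_integralC_eq Λ h2
  exact ⟨μ, rfl⟩

/-- The homeomorphism `μ ↦ (f ↦ ∫ T f dμ)` from the regular probability measures onto the dominated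
functionals. The inverse is continuous because the range of `T` is dense: for `g` in `C(X)` the
integral `∫ g dμ` is, up to a uniformly small error, the value at some `f` of the image of `μ`. -/
def homeoDominated (hT : DenseRange T) (hp : ∀ f c, p f ≤ c ↔ ∀ x, T f x ≤ c) :
    RegProb X ≃ₜ dominated p where
  toEquiv := Equiv.ofBijective _ (toDominated_bijective hT hp)
  continuous_toFun := by
    refine Continuous.subtype_mk (WeakDual.continuous_of_continuous_eval fun f => ?_) _
    exact (ProbabilityMeasure.continuous_integral_boundedContinuousFunction
      (BoundedContinuousFunction.mkOfCompact (T f))).comp continuous_subtype_val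
  continuous_invFun := by
    set e := Equiv.ofBijective _ (toDominated_bijective (X := X) hT hp) with he
    change Continuous e.symm
    refine Continuous.subtype_mk
      (f := fun φ => (e.symm φ).1) ?_ fun φ => (e.symm φ).2
    refine ProbabilityMeasure.continuous_iff_forall_continuous_integral.2 fun g => ?_
    refine continuous_of_uniform_approx_of_continuous fun u hu => ?_
    obtain ⟨ε, hε, hu⟩ := Metric.mem_uniformity_dist.1 hu
    obtain ⟨f, hf⟩ := hT.exists_dist_lt g.toContinuousMap hε
    refine ⟨fun φ => φ.1 f, (WeakDual.eval_continuous f).comp continuous_subtype_val,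
      fun φ => hu ?_⟩
    obtain ⟨μ, rfl⟩ := e.surjective φ
    rw [Equiv.symm_apply_apply]
    change dist (integralC μ.meas g.toContinuousMap) (integralC μ.meas (T f)) < ε
    refine lt_of_le_of_lt ?_ hf
    rw [dist_eq_norm, dist_eq_norm, ← map_sub, Real.norm_eq_abs, abs_le]
    constructor
    · have := integralC_le μ.meas (g := -(g.toContinuousMap - T f)) fun x =>
        (neg_le_abs _).trans ((g.toContinuousMap - T f).norm_coe_le_norm x)
      rw [map_neg] at this
      linarith
    · exact integralC_le _ fun x =>
        (le_abs_self _).trans ((g.toContinuousMap - T f).norm_coe_le_norm x)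

theorem homeoDominated_apply (hT : DenseRange T) (hp : ∀ f c, p f ≤ c ↔ ∀ x, T f x ≤ c)
    (μ : RegProb X) : (homeoDominated hT hp μ : WeakDual ℝ E) = pullback T (integralC μ.meas) :=
  rfl

theorem homeoDominated_mix (hT : DenseRange T) (hp : ∀ f c, p f ≤ c ↔ ∀ x, T f x ≤ c)
    (a b : ℝ≥0) (h : a + b = 1) (μ ν : RegProb X) :
    (homeoDominated hT hp (RegProb.mix a b h μ ν) : WeakDual ℝ E) =
      (a : ℝ) • (homeoDominated hT hp μ : WeakDual ℝ E)
        + (b : ℝ) • (homeoDominated hT hp ν : WeakDual ℝ E) := by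
  simp only [homeoDominated_apply, integralC_mix]
  rfl

end Representation

/-! ### The lattice property of the cone -/

section Lattice

variable {X : Type*} [TopologicalSpace X] [CompactSpace X] [MeasurableSpace X]
  [BorelSpace X] {E : Type*} [NormedAddCommGroup E] [NormedSpace ℝ E]
  {p : E → ℝ}

/-- The point of `E* × ℝ` given by a finite measure: the functional `f ↦ ∫ T f dm` together with
the total mass. -/
def conePoint (T : E →L[ℝ] C(X, ℝ)) (m : Measure X) [IsFiniteMeasure m] : WeakDual ℝ E × ℝ :=
  (pullback T (integralC m), m.real univ)

theorem conePoint_add (T : E →L[ℝ] C(X, ℝ)) (m n : Measure X) [IsFiniteMeasure m]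
    [IsFiniteMeasure n] : conePoint T (m + n) = conePoint T m + conePoint T n := by
  refine Prod.ext ?_ measureReal_add_apply
  simp only [conePoint, integralC_add]
  rfl

variable {T : E →L[ℝ] C(X, ℝ)}

theorem zero_mem_coneOver {F : Type*} [AddCommGroup F] [Module ℝ F] {K : Set F}
    (hK : K.Nonempty) : (0 : F × ℝ) ∈ coneOver K := by
  obtain ⟨x, hx⟩ := hK
  exact ⟨0, le_rfl, x, hx, by rw [zero_smul]; rfl⟩

theorem conePoint_mem_coneOver (hp : ∀ f c, p f ≤ c ↔ ∀ x, T f x ≤ c)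
    (hK : (dominated p).Nonempty) (m : Measure X)
    [IsFiniteMeasure m] : conePoint T m ∈ coneOver (dominated p) := by
  rcases eq_or_ne m 0 with rfl | hm
  · convert zero_mem_coneOver hK
    refine Prod.ext (DFunLike.ext _ _ fun f => ?_) (by simp [conePoint])
    exact integral_zero_measure _
  have hr : m.real univ ≠ 0 := by
    simpa [measureReal_def, ENNReal.toReal_eq_zero_iff] using hm
  refine ⟨m.real univ, measureReal_nonneg,
    pullback T ((m.real univ)⁻¹ • integralC m), fun f => ?_, ?_⟩
  · have h1 : ∀ x, T f x ≤ p f := (hp f _).1 le_rfl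
    have h2 := integral_mono (integrable_continuousMap m (T f)) (integrable_const (p f)) h1
    rw [integral_const, smul_eq_mul] at h2
    change (m.real univ)⁻¹ * ∫ x, T f x ∂m ≤ p f
    rwa [inv_mul_le_iff₀ (lt_of_le_of_ne measureReal_nonneg hr.symm)]
  · refine Prod.ext (DFunLike.ext _ _ fun f => ?_) rfl
    change ∫ x, T f x ∂m = m.real univ * ((m.real univ)⁻¹ * ∫ x, T f x ∂m)
    rw [mul_inv_cancel_left₀ hr]

theorem conePoint_sub_mem_coneOver (hp : ∀ f c, p f ≤ c ↔ ∀ x, T f x ≤ c)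
    (hK : (dominated p).Nonempty) {m n : Measure X}
    [IsFiniteMeasure m] [IsFiniteMeasure n] (h : m ≤ n) :
    conePoint T n - conePoint T m ∈ coneOver (dominated p) := by
  have : IsFiniteMeasure (n - m) := isFiniteMeasure_of_le n Measure.sub_le
  have h1 := conePoint_add T (n - m) m
  simp only [Measure.sub_add_cancel_of_le h] at h1
  rw [h1, add_sub_cancel_right]
  exact conePoint_mem_coneOver hp hK _

variable [T2Space X]

theorem exists_conePoint_eq (hT : DenseRange T) (hp : ∀ f c, p f ≤ c ↔ ∀ x, T f x ≤ c)
    {u : WeakDual ℝ E × ℝ} (hu : u ∈ coneOver (dominated p)) :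
    ∃ m : Measure X, ∃ _ : IsFiniteMeasure m, m.Regular ∧ conePoint T m = u := by
  obtain ⟨r, hr, φ, hφ, rfl⟩ := hu
  obtain ⟨Λ, rfl, h2⟩ := exists_pullback_eq_of_mem_dominated hT hp hφ
  obtain ⟨μ, rfl⟩ := exists_regProb_integralC_eq Λ h2
  have := μ.2
  lift r to ℝ≥0 using hr
  refine ⟨r • μ.meas, inferInstance, inferInstance, Prod.ext (DFunLike.ext _ _ fun f => ?_) ?_⟩
  · exact integral_smul_nnreal_measure _ _
  · simp [conePoint]

theorem conePoint_injective (hT : DenseRange T) {m n : Measure X} [IsFiniteMeasure m]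
    [IsFiniteMeasure n] [m.Regular] [n.Regular] (h : conePoint T m = conePoint T n) : m = n :=
  integralC_injective (pullback_injective hT (congrArg Prod.fst h))

/-- The span of the cone consists of the points given by differences of regular measures. -/
theorem exists_sub_of_mem_span (hT : DenseRange T) (hp : ∀ f c, p f ≤ c ↔ ∀ x, T f x ≤ c)
    (hK : (dominated p).Nonempty)
    {u : WeakDual ℝ E × ℝ} (hu : u ∈ Submodule.span ℝ (coneOver (dominated p))) :
    ∃ m : Measure X, ∃ _ : IsFiniteMeasure m, ∃ n : Measure X, ∃ _ : IsFiniteMeasure n,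
      m.Regular ∧ n.Regular ∧ u = conePoint T m - conePoint T n := by
  have key : ∀ v ∈ coneOver (dominated p), ∀ r : ℝ, 0 ≤ r → r • v ∈ coneOver (dominated p) := by
    rintro _ ⟨s, hs, φ, hφ, rfl⟩ r hr
    exact ⟨r * s, mul_nonneg hr hs, φ, hφ, by simp [mul_smul]⟩
  have hz := zero_mem_coneOver hK
  induction hu using Submodule.closure_induction with
  | zero =>
    obtain ⟨m, hm, hm', h⟩ := exists_conePoint_eq hT hp hz
    exact ⟨m, hm, m, hm, hm', hm', by simp⟩
  | add u v _ _ hu hv =>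
    obtain ⟨a, ha, b, hb, ha', hb', rfl⟩ := hu
    obtain ⟨c, hc, d, hd, hc', hd', rfl⟩ := hv
    refine ⟨a + c, inferInstance, b + d, inferInstance, regular_add _ _, regular_add _ _, ?_⟩
    rw [conePoint_add, conePoint_add]
    abel
  | smul_mem r v hv =>
    obtain ⟨z, hz', hzr, h0⟩ := exists_conePoint_eq hT hp hz
    rcases le_total 0 r with hr | hr
    · obtain ⟨m, hm, hm', h⟩ := exists_conePoint_eq hT hp (key v hv r hr)
      exact ⟨m, hm, z, hz', hm', hzr, by rw [h, h0, sub_zero]⟩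
    · obtain ⟨m, hm, hm', h⟩ := exists_conePoint_eq hT hp (key v hv (-r) (by linarith))
      exact ⟨z, hz', m, hm, hzr, hm', by rw [h, h0, zero_sub, neg_smul, neg_neg]⟩

/-- The supremum of two differences of measures `a - b` and `c - d` is
`((a + d) ⊔ (c + b)) - (b + d)`. An upper bound exceeds them by measures `m` and `n` with
`m + (a + d) = n + (c + b)`; here the measures have to be regular for the functionals to determine
them. -/
theorem span_coneOver_sup (hT : DenseRange T) (hp : ∀ f c, p f ≤ c ↔ ∀ x, T f x ≤ c)
    (hK : (dominated p).Nonempty)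
    (u : WeakDual ℝ E × ℝ)
    (hu : u ∈ Submodule.span ℝ (coneOver (dominated p)))
    (v : WeakDual ℝ E × ℝ)
    (hv : v ∈ Submodule.span ℝ (coneOver (dominated p))) :
    ∃ w ∈ Submodule.span ℝ (coneOver (dominated p)),
      w - u ∈ coneOver (dominated p) ∧ w - v ∈ coneOver (dominated p) ∧
      ∀ z ∈ Submodule.span ℝ (coneOver (dominated p)),
        z - u ∈ coneOver (dominated p) → z - v ∈ coneOver (dominated p) →
          z - w ∈ coneOver (dominated p) := by
  obtain ⟨a, _, b, _, _, _, rfl⟩ := exists_sub_of_mem_span hT hp hK hu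
  obtain ⟨c, _, d, _, _, _, rfl⟩ := exists_sub_of_mem_span hT hp hK hv
  have hle : (a + d) ⊔ (c + b) ≤ (a + d) + (c + b) :=
    sup_le (Measure.le_add_right le_rfl) (Measure.le_add_left le_rfl)
  have : IsFiniteMeasure ((a + d) ⊔ (c + b)) := isFiniteMeasure_of_le _ hle
  set s := (a + d) ⊔ (c + b)
  have hmem : ∀ (m : Measure X) [IsFiniteMeasure m],
      conePoint T m ∈ Submodule.span ℝ (coneOver (dominated p)) := fun m _ =>
    Submodule.subset_span (conePoint_mem_coneOver hp hK m)
  refine ⟨conePoint T s - conePoint T (b + d), sub_mem (hmem _) (hmem _), ?_, ?_, ?_⟩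
  · convert conePoint_sub_mem_coneOver hp hK (le_sup_left : a + d ≤ s) using 1
    simp only [conePoint_add]
    abel
  · convert conePoint_sub_mem_coneOver hp hK (le_sup_right : c + b ≤ s) using 1
    simp only [conePoint_add]
    abel
  · intro z _ h1 h2
    obtain ⟨m, _, _, hm⟩ := exists_conePoint_eq hT hp h1
    obtain ⟨n, _, _, hn⟩ := exists_conePoint_eq hT hp h2
    have := regular_add a d
    have := regular_add c b
    have := regular_add m (a + d)
    have := regular_add n (c + b)
    have heq : m + (a + d) = n + (c + b) := conePoint_injective hT <| by
      simp only [conePoint_add, hm, hn]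
      abel
    have hs : s ≤ m + (a + d) :=
      sup_le (Measure.le_add_left le_rfl) (heq ▸ Measure.le_add_left le_rfl)
    convert conePoint_sub_mem_coneOver hp hK hs using 1
    simp only [conePoint_add, hm]
    abel

end Lattice

/-! ### Extreme points -/

section Extreme

variable {X : Type*} [TopologicalSpace X] [CompactSpace X]
  {E : Type*} [NormedAddCommGroup E] [NormedSpace ℝ E]
  {T : E →L[ℝ] C(X, ℝ)} {p : E → ℝ}

theorem evalAt_mem_extremePoints (hT : DenseRange T) (hp : ∀ f c, p f ≤ c ↔ ∀ x, T f x ≤ c)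
    (x : X) : pullback T (evalAt x) ∈ (dominated p).extremePoints ℝ := by
  refine mem_extremePoints.2 ⟨pullback_mem_dominated hp fun g c h => h x, ?_⟩
  intro φ hφ ψ hψ hseg
  obtain ⟨Λ, rfl, hΛ⟩ := exists_pullback_eq_of_mem_dominated hT hp hφ
  obtain ⟨Γ, rfl, hΓ⟩ := exists_pullback_eq_of_mem_dominated hT hp hψ
  obtain ⟨a, b, ha, hb, -, hab⟩ := hseg
  have heq : a • Λ + b • Γ = evalAt x := pullback_injective hT hab
  have key : ∀ g : C(X, ℝ), (∀ y, 0 ≤ g y) → g x = 0 → Λ g = 0 ∧ Γ g = 0 := fun g hg hx => by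
    have h1 : a * Λ g + b * Γ g = 0 := (congrArg (fun Θ => Θ g) heq).trans hx
    have h2 := mul_nonneg ha.le (nonneg_of_le_max hΛ hg)
    have h3 := mul_nonneg hb.le (nonneg_of_le_max hΓ hg)
    constructor
    · exact (mul_eq_zero.1 (by linarith : a * Λ g = 0)).resolve_left ha.ne'
    · exact (mul_eq_zero.1 (by linarith : b * Γ g = 0)).resolve_left hb.ne'
  rw [eq_evalAt_of_forall hΛ fun g hg hx => (key g hg hx).1,
    eq_evalAt_of_forall hΓ fun g hg hx => (key g hg hx).2]
  exact ⟨rfl, rfl⟩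

/-- The functional `h ↦ c Λ(g h)`. -/
def mulFunctional (Λ : C(X, ℝ) →L[ℝ] ℝ) (g : C(X, ℝ)) (c : ℝ) : C(X, ℝ) →L[ℝ] ℝ :=
  c • Λ.comp (ContinuousLinearMap.mul ℝ C(X, ℝ) g)

theorem mulFunctional_apply (Λ : C(X, ℝ) →L[ℝ] ℝ) (g : C(X, ℝ)) (c : ℝ) (h : C(X, ℝ)) :
    mulFunctional Λ g c h = c * Λ (g * h) := rfl

theorem mulFunctional_le_max {Λ : C(X, ℝ) →L[ℝ] ℝ} (hΛ : ∀ g c, (∀ x, g x ≤ c) → Λ g ≤ c)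
    {g : C(X, ℝ)} (hg : ∀ x, 0 ≤ g x) (hpos : 0 < Λ g) (h : C(X, ℝ)) (c : ℝ)
    (hc : ∀ x, h x ≤ c) : mulFunctional Λ g (Λ g)⁻¹ h ≤ c := by
  have h1 := nonneg_of_le_max hΛ (g := c • g - g * h) fun x => by
    have := mul_le_mul_of_nonneg_left (hc x) (hg x)
    simp only [ContinuousMap.sub_apply, ContinuousMap.smul_apply, ContinuousMap.mul_apply,
      smul_eq_mul]
    linarith
  rw [map_sub, map_smul, smul_eq_mul] at h1
  rw [mulFunctional_apply, inv_mul_le_iff₀ hpos]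
  linarith

/-- For `0 < g < 1` an extreme functional `Λ` is a proper convex combination of the dominated
functionals `Λ (g ·) / Λ g` and `Λ ((1 - g) ·) / Λ (1 - g)`, so that it agrees with the first. -/
theorem map_mul_of_mem_extremePoints_aux (hT : DenseRange T)
    (hp : ∀ f c, p f ≤ c ↔ ∀ x, T f x ≤ c) {Λ : C(X, ℝ) →L[ℝ] ℝ}
    (hΛ : ∀ g c, (∀ x, g x ≤ c) → Λ g ≤ c)
    (hext : pullback T Λ ∈ (dominated p).extremePoints ℝ) {g : C(X, ℝ)}
    (h1 : ∀ x, 1 / 4 ≤ g x) (h2 : ∀ x, g x ≤ 3 / 4) (h : C(X, ℝ)) : Λ (g * h) = Λ g * Λ h := by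
  have hone := apply_one_of_le_max hΛ
  have hg1 : 0 < Λ g := by
    have := hΛ (-g) (-(1 / 4)) fun x => neg_le_neg (h1 x)
    rw [map_neg] at this
    linarith
  have hg2 : Λ g < 1 := lt_of_le_of_lt (hΛ g _ h2) (by norm_num)
  have hg3 : Λ (1 - g) = 1 - Λ g := by rw [map_sub, hone]
  have hm1 := pullback_mem_dominated hp (mulFunctional_le_max hΛ (g := g)
    (fun x => le_trans (by norm_num) (h1 x)) hg1)
  have hm2 := pullback_mem_dominated hp (mulFunctional_le_max hΛ (g := 1 - g)
    (fun x => by simpa using (h2 x).trans (by norm_num)) (by linarith))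
  have hcomb : pullback T Λ ∈ openSegment ℝ (pullback T (mulFunctional Λ g (Λ g)⁻¹))
      (pullback T (mulFunctional Λ (1 - g) (Λ (1 - g))⁻¹)) := by
    refine ⟨Λ g, Λ (1 - g), hg1, by linarith, by linarith, DFunLike.ext _ _ fun f => ?_⟩
    change Λ g * ((Λ g)⁻¹ * Λ (g * T f)) + Λ (1 - g) * ((Λ (1 - g))⁻¹ * Λ ((1 - g) * T f))
      = Λ (T f)
    rw [mul_inv_cancel_left₀ hg1.ne', mul_inv_cancel_left₀ (by linarith), ← map_add, ← add_mul,
      add_sub_cancel, one_mul]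
  have heq := pullback_injective hT ((mem_extremePoints.1 hext).2 _ hm1 _ hm2 hcomb).1
  have h3 : mulFunctional Λ g (Λ g)⁻¹ h = Λ h := congrArg (fun Θ => Θ h) heq
  rwa [mulFunctional_apply, inv_mul_eq_iff_eq_mul₀ hg1.ne'] at h3

theorem map_mul_of_mem_extremePoints (hT : DenseRange T)
    (hp : ∀ f c, p f ≤ c ↔ ∀ x, T f x ≤ c) {Λ : C(X, ℝ) →L[ℝ] ℝ}
    (hΛ : ∀ g c, (∀ x, g x ≤ c) → Λ g ≤ c)
    (hext : pullback T Λ ∈ (dominated p).extremePoints ℝ) (g h : C(X, ℝ)) :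
    Λ (g * h) = Λ g * Λ h := by
  -- Both sides are linear in `g` and agree for `g = 1`, so that `g` may be replaced by
  -- `1 / 2 + s g`, which lies between `1 / 4` and `3 / 4` for small `s`.
  obtain ⟨s, hs, hs'⟩ : ∃ s : ℝ, 0 < s ∧ s * ‖g‖ ≤ 1 / 4 := by
    have : 0 < ‖g‖ + 1 := by positivity
    refine ⟨1 / (4 * (‖g‖ + 1)), by positivity, ?_⟩
    rw [div_mul_eq_mul_div, div_le_iff₀ (by positivity)]
    linarith
  have hb : ∀ x, |s * g x| ≤ 1 / 4 := fun x => by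
    rw [abs_mul, abs_of_pos hs]
    exact (mul_le_mul_of_nonneg_left (g.norm_coe_le_norm x) hs.le).trans hs'
  have key := map_mul_of_mem_extremePoints_aux hT hp hΛ hext
    (g := (1 / 2 : ℝ) • (1 : C(X, ℝ)) + s • g)
    (fun x => by
      have := (abs_le.1 (hb x)).1
      simp only [ContinuousMap.add_apply, ContinuousMap.smul_apply, ContinuousMap.one_apply,
        smul_eq_mul]
      linarith)
    (fun x => by
      have := (abs_le.1 (hb x)).2
      simp only [ContinuousMap.add_apply, ContinuousMap.smul_apply, ContinuousMap.one_apply,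
        smul_eq_mul]
      linarith) h
  simp only [add_mul, smul_mul_assoc, one_mul, map_add, map_smul, apply_one_of_le_max hΛ,
    smul_eq_mul] at key
  refine mul_left_cancel₀ hs.ne' ?_
  linarith

theorem extremePoints_dominated [T2Space X] (hT : DenseRange T)
    (hp : ∀ f c, p f ≤ c ↔ ∀ x, T f x ≤ c) :
    (dominated p).extremePoints ℝ = range fun x : X => pullback T (evalAt x) := by
  refine Subset.antisymm (fun φ hφ => ?_)
    (range_subset_iff.2 fun x => evalAt_mem_extremePoints hT hp x)
  obtain ⟨Λ, rfl, hΛ⟩ := exists_pullback_eq_of_mem_dominated hT hp (extremePoints_subset hφ)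
  let χ : WeakDual.characterSpace ℝ C(X, ℝ) := ⟨StrongDual.toWeakDual Λ, by
    rw [WeakDual.CharacterSpace.eq_set_map_one_map_mul]
    exact ⟨apply_one_of_le_max hΛ, map_mul_of_mem_extremePoints hT hp hΛ hφ⟩⟩
  obtain ⟨x, hx⟩ := (WeakDual.CharacterSpace.continuousMapEval_bijective X ℝ).2 χ
  refine ⟨x, congrArg (pullback T) ?_⟩
  ext g
  exact congrArg (fun χ : WeakDual.characterSpace ℝ C(X, ℝ) => χ g) hx

/-- The set of functionals dominated by `p f = max (T f)` is a Bauer simplex, as it is a copy of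
the set of regular probability measures on `X`. -/
theorem isBauerSimplex_dominated [T2Space X] [MeasurableSpace X] [BorelSpace X]
    (hT : DenseRange T) (hp : ∀ f c, p f ≤ c ↔ ∀ x, T f x ≤ c) :
    IsBauerSimplex (dominated p) := by
  have hX : Nonempty X := by
    by_contra hX
    rw [not_nonempty_iff] at hX
    have := (hp 0 (p 0 - 1)).2 fun x => hX.elim x
    linarith
  have hK : (dominated p).Nonempty :=
    ⟨_, pullback_mem_dominated hp (Λ := evalAt hX.some) fun g c h => h _⟩
  refine ⟨⟨hK, isCompact_dominated hp, convex_dominated p, span_coneOver_sup hT hp hK⟩, ?_⟩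
  rw [extremePoints_dominated hT hp]
  exact (isCompact_range (continuous_pullback_evalAt T)).isClosed

end Extreme

/-! ### Slowly varying functions -/

section SlowlyVarying

/-- Bounded functions on `[1, ∞)` with `|F y - F x| = O((y - x + 1) / y)` for `x ≤ y`. The
summand `1` leaves room for jumps of size `O(1 / y)`, such as those of `x ↦ sumMean f x`. -/
def SlowlyVarying (F : ℝ → ℝ) : Prop :=
  ∃ C, 0 ≤ C ∧ (∀ x, 1 ≤ x → |F x| ≤ C) ∧
    ∀ x y, 1 ≤ x → x ≤ y → |F y - F x| * y ≤ C * (y - x + 1)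

namespace SlowlyVarying

variable {F G : ℝ → ℝ}

theorem const (c : ℝ) : SlowlyVarying fun _ => c := by
  refine ⟨|c|, abs_nonneg c, fun _ _ => le_rfl, fun x y _ hxy => ?_⟩
  rw [sub_self, abs_zero, zero_mul]
  exact mul_nonneg (abs_nonneg c) (by linarith)

theorem add (hF : SlowlyVarying F) (hG : SlowlyVarying G) : SlowlyVarying fun x => F x + G x := by
  obtain ⟨C, hC, h1, h2⟩ := hF
  obtain ⟨D, hD, h3, h4⟩ := hG
  refine ⟨C + D, add_nonneg hC hD,
    fun x hx => (abs_add_le _ _).trans (add_le_add (h1 x hx) (h3 x hx)), fun x y hx hxy => ?_⟩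
  have h5 : |F y + G y - (F x + G x)| ≤ |F y - F x| + |G y - G x| := by
    rw [add_sub_add_comm]
    exact abs_add_le _ _
  have h6 := mul_le_mul_of_nonneg_right h5 (by linarith : 0 ≤ y)
  linarith [h2 x y hx hxy, h4 x y hx hxy]

theorem mul (hF : SlowlyVarying F) (hG : SlowlyVarying G) : SlowlyVarying fun x => F x * G x := by
  obtain ⟨C, hC, h1, h2⟩ := hF
  obtain ⟨D, hD, h3, h4⟩ := hG
  refine ⟨2 * (C * D), by positivity, fun x hx => ?_, fun x y hx hxy => ?_⟩
  · rw [abs_mul]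
    have := mul_le_mul (h1 x hx) (h3 x hx) (abs_nonneg _) hC
    linarith [mul_nonneg hC hD]
  · have hy : 0 ≤ y := by linarith
    have h5 : |F y * G y - F x * G x| ≤ C * |G y - G x| + D * |F y - F x| := by
      have : F y * G y - F x * G x = F y * (G y - G x) + G x * (F y - F x) := by ring
      rw [this]
      refine (abs_add_le _ _).trans ?_
      rw [abs_mul, abs_mul]
      exact add_le_add (mul_le_mul_of_nonneg_right (h1 y (hx.trans hxy)) (abs_nonneg _))
        (mul_le_mul_of_nonneg_right (h3 x hx) (abs_nonneg _))
    have h6 := mul_le_mul_of_nonneg_right h5 hy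
    have h7 := mul_le_mul_of_nonneg_left (h2 x y hx hxy) hD
    have h8 := mul_le_mul_of_nonneg_left (h4 x y hx hxy) hC
    nlinarith

/-- A quotient `S x / x` varies slowly if `S` has increments of linear size. -/
theorem of_div {S : ℝ → ℝ} {B : ℝ} (hB : 0 ≤ B) (h1 : ∀ x, 1 ≤ x → |S x| ≤ B * x)
    (h2 : ∀ x y, 1 ≤ x → x ≤ y → |S y - S x| ≤ B * (y - x + 1)) :
    SlowlyVarying fun x => 1 / x * S x := by
  refine ⟨2 * B, by positivity, fun x hx => ?_, fun x y hx hxy => ?_⟩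
  · have hx0 : 0 < x := by linarith
    rw [abs_mul, abs_of_pos (one_div_pos.2 hx0), one_div, inv_mul_le_iff₀ hx0]
    nlinarith [h1 x hx, mul_nonneg hB hx0.le]
  · have hx0 : 0 < x := by linarith
    have hy0 : 0 < y := by linarith
    have h3 : |1 / y * S y - 1 / x * S x| * y = |(S y - S x) - S x / x * (y - x)| := by
      rw [← abs_of_pos hy0, ← abs_mul, abs_of_pos hy0]
      congr 1
      field_simp
      ring
    have h4 : |S x / x * (y - x)| ≤ B * (y - x) := by
      rw [abs_mul, abs_of_nonneg (sub_nonneg.2 hxy)]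
      refine mul_le_mul_of_nonneg_right ?_ (sub_nonneg.2 hxy)
      rw [abs_div, abs_of_pos hx0, div_le_iff₀ hx0]
      exact h1 x hx
    rw [h3]
    have h5 := abs_sub (S y - S x) (S x / x * (y - x))
    linarith [h2 x y hx hxy]

/-- Bounded Lipschitz functions of `log x` vary slowly. -/
theorem of_logb {h : ℝ → ℝ} (h1 : ∀ u, |h u| ≤ 1) (h2 : ∀ u v, |h u - h v| ≤ |u - v|) :
    SlowlyVarying fun x => h (Real.logb 2 x) := by
  refine ⟨4, by norm_num, fun x _ => (h1 _).trans (by norm_num), fun x y hx hxy => ?_⟩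
  have hx0 : 0 < x := by linarith
  have hy0 : 0 < y := by linarith
  rcases le_total y (2 * x) with hy | hy
  · have h3 : Real.logb 2 y - Real.logb 2 x ≤ 2 * (y / x - 1) := by
      rw [← Real.logb_div hy0.ne' hx0.ne', Real.logb, div_le_iff₀ (Real.log_pos one_lt_two)]
      have h4 := Real.log_le_sub_one_of_pos (div_pos hy0 hx0)
      have h5 : 0 ≤ y / x - 1 := by rw [sub_nonneg, le_div_iff₀ hx0]; linarith
      nlinarith [Real.log_two_gt_d9]
    have h4 : 0 ≤ Real.logb 2 y - Real.logb 2 x :=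
      sub_nonneg.2 (Real.logb_le_logb_of_le one_lt_two hx0 hxy)
    have h5 : |h (Real.logb 2 y) - h (Real.logb 2 x)| ≤ 2 * (y / x - 1) :=
      (h2 _ _).trans (by rwa [abs_of_nonneg h4])
    have h6 : 2 * (y / x - 1) * y = 2 * (y - x) * (y / x) := by field_simp
    have h7 : y / x ≤ 2 := by rwa [div_le_iff₀ hx0]
    have h8 := mul_le_mul_of_nonneg_right h5 hy0.le
    have h9 := mul_le_mul_of_nonneg_left h7 (by linarith : 0 ≤ 2 * (y - x))
    linarith
  · have h3 : |h (Real.logb 2 y) - h (Real.logb 2 x)| ≤ 2 :=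
      (abs_sub _ _).trans (by linarith [h1 (Real.logb 2 y), h1 (Real.logb 2 x)])
    have h4 := mul_le_mul_of_nonneg_right h3 hy0.le
    linarith

theorem exists_abs_sub_le (hF : SlowlyVarying F) :
    ∃ C, ∀ x y, 1 ≤ x → 1 ≤ y → |F y - F x| ≤ C * (|y / x - 1| + 1 / x) := by
  obtain ⟨C, hC, -, h2⟩ := hF
  refine ⟨C, fun x y hx hy => ?_⟩
  have hx0 : 0 < x := by linarith
  have h3 : |y / x - 1| + 1 / x = (|y - x| + 1) / x := by
    rw [add_div, ← abs_of_pos hx0, ← abs_div, abs_of_pos hx0, sub_div, div_self hx0.ne']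
  rw [h3, ← mul_div_assoc, le_div_iff₀ hx0]
  rcases le_total x y with hxy | hxy
  · rw [abs_of_nonneg (sub_nonneg.2 hxy)]
    exact (mul_le_mul_of_nonneg_left hxy (abs_nonneg _)).trans (h2 x y hx hxy)
  · rw [abs_sub_comm, abs_sub_comm y, abs_of_nonneg (sub_nonneg.2 hxy)]
    exact h2 y x hy hxy

theorem tendsto_sub {α : Type*} {l : Filter α} {a b : α → ℝ} (hF : SlowlyVarying F)
    (ha : Tendsto a l atTop) (hr : Tendsto (fun i => b i / a i) l (𝓝 1)) :
    Tendsto (fun i => F (b i) - F (a i)) l (𝓝 0) := by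
  obtain ⟨C, hC⟩ := hF.exists_abs_sub_le
  have hb : Tendsto b l atTop := by
    refine (hr.pos_mul_atTop one_pos ha).congr' ?_
    filter_upwards [ha.eventually_gt_atTop 0] with i hi
    exact div_mul_cancel₀ _ hi.ne'
  have hlim : Tendsto (fun i => C * (|b i / a i - 1| + 1 / a i)) l (𝓝 0) := by
    have h1 : Tendsto (fun i => |b i / a i - 1|) l (𝓝 0) := by
      simpa using (hr.sub_const 1).abs
    have h2 : Tendsto (fun i => 1 / a i) l (𝓝 0) := ha.const_div_atTop 1
    simpa using (h1.add h2).const_mul C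
  refine squeeze_zero_norm' ?_ hlim
  filter_upwards [ha.eventually_ge_atTop 1, hb.eventually_ge_atTop 1] with i hi hi'
  exact hC _ _ hi hi'

theorem eventually_abs_le (hF : SlowlyVarying F) : ∃ C, ∀ᶠ x in atTop, |F x| ≤ C := by
  obtain ⟨C, -, h, -⟩ := hF
  exact ⟨C, (eventually_ge_atTop 1).mono h⟩

end SlowlyVarying

theorem tendsto_ulim {α : Type*} {U : Ultrafilter α} {g : α → ℝ} {C : ℝ}
    (h : ∀ᶠ a in (U : Filter α), |g a| ≤ C) : Tendsto g U (𝓝 (ulim U g)) := by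
  refine tendsto_nhds_limUnder ?_
  obtain ⟨x, -, hx⟩ := isCompact_iff_ultrafilter_le_nhds'.1 (isCompact_Icc (a := -C) (b := C))
    (U.map g) (h.mono fun a ha => abs_le.1 ha)
  exact ⟨x, hx⟩

end SlowlyVarying

/-! ### The space `Ω*` and limits of slowly varying functions -/

section Suspension

theorem mem_freeUltrafilters_iff {η : Ultrafilter ℕ+} :
    η ∈ freeUltrafilters ↔ (η : Filter ℕ+) ≤ cofinite := by
  refine ⟨fun h => ?_, fun h n hn => ?_⟩
  · rcases η.le_cofinite_or_eq_pure with h' | ⟨n, rfl⟩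
    · exact h'
    · exact absurd rfl (h n)
  · subst hn
    have := h (Set.finite_singleton n).compl_mem_cofinite
    simp at this

theorem shift_mem_freeUltrafilters_iff {η : Ultrafilter ℕ+} :
    shift η ∈ freeUltrafilters ↔ η ∈ freeUltrafilters := by
  have hinj : Function.Injective fun n : ℕ+ => n + 1 := add_left_injective 1
  rw [mem_freeUltrafilters_iff, mem_freeUltrafilters_iff, shift, Ultrafilter.coe_map,
    map_le_iff_le_comap, hinj.comap_cofinite_eq]

theorem mk_mem_OmegaStar_iff {p : Ultrafilter ℕ+ × unitInterval} :
    (Quot.mk glue p : Omega) ∈ OmegaStar ↔ p.1 ∈ freeUltrafilters := by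
  refine ⟨?_, fun h => ⟨p.1, h, p.2, rfl⟩⟩
  let isFree : Omega → Prop := Quot.lift (fun p => p.1 ∈ freeUltrafilters) fun p q h => by
    simp only [h.2.2, shift_mem_freeUltrafilters_iff]
  rintro ⟨η, hη, t, h⟩
  have h1 : isFree (Quot.mk glue p) = isFree (Quot.mk glue (η, t)) := congrArg isFree h
  exact h1.mpr hη

theorem isClosed_freeUltrafilters : IsClosed freeUltrafilters := by
  have : freeUltrafilters = ⋂ n : ℕ+, {η : Ultrafilter ℕ+ | {n}ᶜ ∈ η} := by
    ext η
    rw [mem_freeUltrafilters_iff, Set.mem_iInter]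
    refine ⟨fun h n => h (Set.finite_singleton n).compl_mem_cofinite, fun h => ?_⟩
    rcases η.le_cofinite_or_eq_pure with h' | ⟨n, rfl⟩
    · exact h'
    · simpa using h n
  rw [this]
  exact isClosed_iInter fun n => ultrafilter_isClosed_basic _

/-- The quotient map from `ℕ* × [0, 1]` onto `Ω*`. -/
def toOmegaStar (p : freeUltrafilters × unitInterval) : OmegaStar :=
  ⟨Quot.mk glue (p.1.1, p.2), p.1.1, p.1.2, p.2, rfl⟩

theorem continuous_toOmegaStar : Continuous toOmegaStar := by
  refine Continuous.subtype_mk ?_ _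
  exact continuous_quot_mk.comp
    ((continuous_subtype_val.comp continuous_fst).prodMk continuous_snd)

theorem surjective_toOmegaStar : Function.Surjective toOmegaStar := by
  rintro ⟨_, η, hη, t, rfl⟩
  exact ⟨(⟨η, hη⟩, t), rfl⟩

/-- The subspace topology of `Ω* ⊆ Ω` is the quotient topology, since `ℕ* × [0, 1]` is closed
and saturated. -/
theorem isQuotientMap_toOmegaStar : IsQuotientMap toOmegaStar := by
  refine isQuotientMap_iff_isClosed.2 ⟨surjective_toOmegaStar, fun s =>
    ⟨fun hs => hs.preimage continuous_toOmegaStar, fun hs => ?_⟩⟩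
  let j : freeUltrafilters × unitInterval → Ultrafilter ℕ+ × unitInterval := Prod.map Subtype.val id
  have hj : IsClosedEmbedding j :=
    isClosed_freeUltrafilters.isClosedEmbedding_subtypeVal.prodMap IsClosedEmbedding.id
  let q : Ultrafilter ℕ+ × unitInterval → Omega := Quot.mk glue
  have hq : IsQuotientMap q := isQuotientMap_quot_mk
  have himg : q ⁻¹' (Subtype.val '' s) = j '' (toOmegaStar ⁻¹' s) := by
    ext ⟨η, t⟩
    constructor
    · rintro ⟨ω, hω, h⟩
      have hη : η ∈ freeUltrafilters := mk_mem_OmegaStar_iff.1 (h ▸ ω.2)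
      refine ⟨(⟨η, hη⟩, t), ?_, rfl⟩
      have : toOmegaStar (⟨η, hη⟩, t) = ω := Subtype.ext h.symm
      rwa [mem_preimage, this]
    · rintro ⟨p, hp, h⟩
      exact ⟨_, hp, congrArg q h⟩
  have h1 : IsClosed (Subtype.val '' s : Set Omega) := by
    rw [← hq.isClosed_preimage, himg]
    exact hj.isClosedMap _ hs
  rw [← Set.preimage_image_eq s Subtype.val_injective]
  exact h1.preimage continuous_subtype_val

instance : CompactSpace OmegaStar := by
  have : CompactSpace freeUltrafilters :=
    isCompact_iff_compactSpace.1 isClosed_freeUltrafilters.isCompact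
  exact isQuotientMap_toOmegaStar.surjective.compactSpace continuous_toOmegaStar

theorem tendsto_two_rpow_mul_two_pow {η : Ultrafilter ℕ+} (hη : η ∈ freeUltrafilters) (t : ℝ) :
    Tendsto (fun n : ℕ+ => (2 : ℝ) ^ t * (2 : ℝ) ^ (n : ℕ)) η atTop := by
  have h1 : Tendsto (fun n : ℕ+ => (n : ℕ)) η atTop := by
    rw [← Nat.cofinite_eq_atTop]
    exact PNat.coe_injective.tendsto_cofinite.mono_left (mem_freeUltrafilters_iff.1 hη)
  exact ((tendsto_pow_atTop_atTop_of_one_lt one_lt_two).comp h1).const_mul_atTop (by positivity)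

variable {F G : ℝ → ℝ}

theorem SlowlyVarying.tendsto_limAt_mk (hF : SlowlyVarying F) {η : Ultrafilter ℕ+}
    (hη : η ∈ freeUltrafilters) (t : unitInterval) :
    Tendsto (fun n : ℕ+ => F ((2 : ℝ) ^ (t : ℝ) * (2 : ℝ) ^ (n : ℕ))) η
      (𝓝 (limAt F (Quot.mk glue (η, t)))) := by
  obtain ⟨C, hC⟩ := hF.eventually_abs_le
  exact tendsto_ulim ((tendsto_two_rpow_mul_two_pow hη t).eventually hC)

/-- Each point of `Ω*` is the limit along an ultrafilter on `ℝ` that tends to infinity. -/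
theorem exists_ultrafilter_tendsto_limAt (ω : OmegaStar) :
    ∃ U : Ultrafilter ℝ, (U : Filter ℝ) ≤ atTop ∧
      ∀ F, SlowlyVarying F → Tendsto F U (𝓝 (limAt F ω)) := by
  obtain ⟨⟨⟨η, hη⟩, t⟩, rfl⟩ := surjective_toOmegaStar ω
  refine ⟨η.map fun n : ℕ+ => (2 : ℝ) ^ (t : ℝ) * (2 : ℝ) ^ (n : ℕ),
    tendsto_two_rpow_mul_two_pow hη t, fun F hF => ?_⟩
  exact tendsto_map'_iff.2 (hF.tendsto_limAt_mk hη t)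

/-- Each ultrafilter `U` on `ℝ` that tends to infinity has a limit in `Ω*`: the pair of the image
of `U` under `⌊log₂ x⌋` and the limit along `U` of the fractional part of `log₂ x`. -/
theorem exists_tendsto_limAt_of_ultrafilter (U : Ultrafilter ℝ) (hU : (U : Filter ℝ) ≤ atTop) :
    ∃ ω : OmegaStar, ∀ F, SlowlyVarying F → Tendsto F U (𝓝 (limAt F ω)) := by
  let k : ℝ → ℕ := fun x => ⌊Real.logb 2 x⌋₊
  let τ : ℝ → unitInterval := fun x =>
    ⟨Int.fract (Real.logb 2 x), Int.fract_nonneg _, (Int.fract_lt_one _).le⟩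
  let η : Ultrafilter ℕ+ := U.map fun x => (k x).toPNat'
  obtain ⟨t, -, ht⟩ := isCompact_iff_ultrafilter_le_nhds'.1 (isCompact_univ (X := unitInterval))
    (U.map τ) univ_mem
  have ht' : Tendsto τ U (𝓝 t) := ht
  have hk : Tendsto k U atTop :=
    (tendsto_nat_floor_atTop.comp (Real.tendsto_logb_atTop one_lt_two)).mono_left hU
  have hpos : ∀ᶠ x in (U : Filter ℝ), ((k x).toPNat' : ℕ) = k x :=
    (hk.eventually_gt_atTop 0).mono fun x hx => PNat.toPNat'_coe hx
  have hη : η ∈ freeUltrafilters := by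
    rw [mem_freeUltrafilters_iff]
    change Tendsto (fun x => (k x).toPNat') U cofinite
    have h1 : Tendsto (fun x => ((k x).toPNat' : ℕ)) U cofinite := by
      rw [Nat.cofinite_eq_atTop]
      exact hk.congr' (hpos.mono fun x hx => hx.symm)
    rw [← PNat.coe_injective.comap_cofinite_eq]
    exact tendsto_comap_iff.2 h1
  refine ⟨⟨Quot.mk glue (η, t), mk_mem_OmegaStar_iff.2 hη⟩, fun F hF => ?_⟩
  have h1 : Tendsto (fun x => F ((2 : ℝ) ^ (t : ℝ) * (2 : ℝ) ^ ((k x).toPNat' : ℕ))) U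
      (𝓝 (limAt F (Quot.mk glue (η, t)))) := tendsto_map'_iff.1 (hF.tendsto_limAt_mk hη t)
  have h2 : Tendsto (fun x => (2 : ℝ) ^ (t : ℝ) * (2 : ℝ) ^ ((k x).toPNat' : ℕ)) U atTop :=
    tendsto_map'_iff.1 (tendsto_two_rpow_mul_two_pow hη t)
  have h3 : Tendsto (fun x => x / ((2 : ℝ) ^ (t : ℝ) * (2 : ℝ) ^ ((k x).toPNat' : ℕ))) U
      (𝓝 1) := by
    have h4 : Tendsto (fun x => (2 : ℝ) ^ ((τ x : ℝ) - t)) U (𝓝 1) := by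
      have h5 : Tendsto (fun x => (τ x : ℝ) - t) U (𝓝 0) := by
        have := ((continuous_subtype_val.tendsto t).comp ht').sub_const (t : ℝ)
        rwa [sub_self] at this
      have := (Real.continuous_const_rpow (two_ne_zero)).tendsto (0 : ℝ) |>.comp h5
      rwa [Real.rpow_zero] at this
    refine h4.congr' ?_
    filter_upwards [hpos, hU (eventually_ge_atTop 1)] with x hx hx1
    have hx0 : 0 < x := by linarith
    have h6 : (k x : ℝ) + τ x = Real.logb 2 x := by
      have h7 : (k x : ℝ) = (⌊Real.logb 2 x⌋ : ℝ) :=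
        natCast_floor_eq_intCast_floor (Real.logb_nonneg one_lt_two hx1)
      rw [h7]
      exact Int.floor_add_fract _
    rw [hx, eq_div_iff (by positivity), ← Real.rpow_natCast, ← mul_assoc,
      ← Real.rpow_add two_pos, ← Real.rpow_add two_pos]
    rw [show (τ x : ℝ) - t + t + k x = k x + τ x by ring, h6,
      Real.rpow_logb two_pos (by norm_num) hx0]
  have h4 := (hF.tendsto_sub h2 h3).add h1
  simpa using h4

theorem limAt_eq_of_tendsto_sub (hF : SlowlyVarying F) (hG : SlowlyVarying G)
    (h : Tendsto (fun x => F x - G x) atTop (𝓝 0)) (ω : OmegaStar) : limAt F ω = limAt G ω := by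
  obtain ⟨U, hU, hlim⟩ := exists_ultrafilter_tendsto_limAt ω
  have h1 := ((h.mono_left hU).add (hlim G hG))
  simp only [sub_add_cancel, zero_add] at h1
  exact tendsto_nhds_unique (hlim F hF) h1

theorem limAt_add (hF : SlowlyVarying F) (hG : SlowlyVarying G) (ω : OmegaStar) :
    limAt (fun x => F x + G x) ω = limAt F ω + limAt G ω := by
  obtain ⟨U, hU, hlim⟩ := exists_ultrafilter_tendsto_limAt ω
  exact tendsto_nhds_unique (hlim _ (hF.add hG)) ((hlim F hF).add (hlim G hG))

theorem limAt_mul (hF : SlowlyVarying F) (hG : SlowlyVarying G) (ω : OmegaStar) :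
    limAt (fun x => F x * G x) ω = limAt F ω * limAt G ω := by
  obtain ⟨U, hU, hlim⟩ := exists_ultrafilter_tendsto_limAt ω
  exact tendsto_nhds_unique (hlim _ (hF.mul hG)) ((hlim F hF).mul (hlim G hG))

theorem limAt_const (c : ℝ) (ω : OmegaStar) : limAt (fun _ => c) ω = c := by
  obtain ⟨U, hU, hlim⟩ := exists_ultrafilter_tendsto_limAt ω
  exact tendsto_nhds_unique (hlim _ (SlowlyVarying.const c)) tendsto_const_nhds

/-- The limits are equicontinuous in `t`, and continuous in `η` for fixed `t`. -/
theorem SlowlyVarying.continuous_limAt (hF : SlowlyVarying F) :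
    Continuous fun ω : OmegaStar => limAt F ω := by
  rw [isQuotientMap_toOmegaStar.continuous_iff]
  obtain ⟨C, hC⟩ := hF.exists_abs_sub_le
  let Φ : freeUltrafilters × unitInterval → ℝ := fun p => limAt F (Quot.mk glue (p.1.1, p.2))
  change Continuous Φ
  have hlip : ∀ (η : freeUltrafilters) (s t : unitInterval),
      |Φ (η, s) - Φ (η, t)| ≤ C * |(2 : ℝ) ^ (s : ℝ) / (2 : ℝ) ^ (t : ℝ) - 1| := by
    intro η s t
    have h1 := ((hF.tendsto_limAt_mk η.2 s).sub (hF.tendsto_limAt_mk η.2 t)).abs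
    have h2 : Tendsto (fun n : ℕ+ => C * (|(2 : ℝ) ^ (s : ℝ) / (2 : ℝ) ^ (t : ℝ) - 1|
        + 1 / ((2 : ℝ) ^ (t : ℝ) * (2 : ℝ) ^ (n : ℕ)))) (η : Ultrafilter ℕ+)
        (𝓝 (C * |(2 : ℝ) ^ (s : ℝ) / (2 : ℝ) ^ (t : ℝ) - 1|)) := by
      have h3 := (tendsto_two_rpow_mul_two_pow η.2 t).const_div_atTop 1
      simpa using (h3.const_add |(2 : ℝ) ^ (s : ℝ) / (2 : ℝ) ^ (t : ℝ) - 1|).const_mul C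
    refine le_of_tendsto_of_tendsto h1 h2 ?_
    filter_upwards [(tendsto_two_rpow_mul_two_pow η.2 s).eventually_ge_atTop 1,
      (tendsto_two_rpow_mul_two_pow η.2 t).eventually_ge_atTop 1] with n hs ht
    have h3 := hC _ _ ht hs
    rwa [mul_div_mul_right _ _ (by positivity)] at h3
  rw [continuous_iff_continuousAt]
  rintro ⟨η₀, t₀⟩
  have h1 : Tendsto (fun p : freeUltrafilters × unitInterval => Φ (p.1, t₀)) (𝓝 (η₀, t₀))
      (𝓝 (Φ (η₀, t₀))) := by
    refine Metric.tendsto_nhds.2 fun ε hε => ?_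
    have h2 := Metric.tendsto_nhds.1 (hF.tendsto_limAt_mk η₀.2 t₀) (ε / 2) (half_pos hε)
    have h3 : {p : freeUltrafilters × unitInterval |
        {n : ℕ+ | dist (F ((2 : ℝ) ^ (t₀ : ℝ) * (2 : ℝ) ^ (n : ℕ))) (Φ (η₀, t₀)) < ε / 2}
          ∈ p.1.1} ∈ 𝓝 (η₀, t₀) :=
      ((ultrafilter_isOpen_basic _).preimage
        (continuous_subtype_val.comp continuous_fst)).mem_nhds h2
    filter_upwards [h3] with p hp
    refine lt_of_le_of_lt ?_ (half_lt_self hε)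
    refine le_of_tendsto ((hF.tendsto_limAt_mk p.1.2 t₀).dist tendsto_const_nhds) ?_
    filter_upwards [hp] with n hn using le_of_lt hn
  have h2 : Tendsto (fun p : freeUltrafilters × unitInterval => Φ p - Φ (p.1, t₀)) (𝓝 (η₀, t₀))
      (𝓝 0) := by
    have h3 : Continuous fun p : freeUltrafilters × unitInterval =>
        C * |(2 : ℝ) ^ (p.2 : ℝ) / (2 : ℝ) ^ (t₀ : ℝ) - 1| := by
      have h4 : Continuous fun p : freeUltrafilters × unitInterval => (2 : ℝ) ^ (p.2 : ℝ) :=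
        (Real.continuous_const_rpow two_ne_zero).comp
          (continuous_subtype_val.comp continuous_snd)
      exact (((h4.div_const _).sub continuous_const).abs).const_mul C
    have h4 := h3.tendsto (η₀, t₀)
    rw [div_self (by positivity), sub_self, abs_zero, mul_zero] at h4
    exact squeeze_zero_norm (fun p => hlip p.1 p.2 t₀) h4
  have h3 := h2.add h1
  simpa [ContinuousAt] using h3

end Suspension

/-! ### Separation of points and density -/

section Separation

theorem logb_two_rpow_mul_two_pow (t : ℝ) (n : ℕ) :
    Real.logb 2 ((2 : ℝ) ^ t * (2 : ℝ) ^ n) = n + t := by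
  rw [← Real.rpow_natCast, ← Real.rpow_add two_pos, Real.logb_rpow two_pos (by norm_num), add_comm]

/-- If the sets `A + s` and `B + t` have positive distance, then the distance of `log₂ x` to
`A + s`, truncated at `1`, separates the points `(η, s)` with `A ∈ η` from the points `(ζ, t)`
with `B ∈ ζ`. -/
theorem exists_slowlyVarying_limAt_ne {η ζ : Ultrafilter ℕ+} (hη : η ∈ freeUltrafilters)
    (hζ : ζ ∈ freeUltrafilters) {s t : unitInterval} {A B : Set ℕ+} (hA : A ∈ η) (hB : B ∈ ζ)
    {δ : ℝ} (hδ : 0 < δ) (h : ∀ m ∈ A, ∀ n ∈ B, δ ≤ |((n : ℕ) + t : ℝ) - ((m : ℕ) + s : ℝ)|) :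
    ∃ F, SlowlyVarying F ∧
      limAt F (Quot.mk glue (η, s)) ≠ limAt F (Quot.mk glue (ζ, t)) := by
  let D : Set ℝ := (fun m : ℕ+ => ((m : ℕ) + s : ℝ)) '' A
  have hD : D.Nonempty := (η.nonempty_of_mem hA).image _
  let F : ℝ → ℝ := fun x => min 1 (Metric.infDist (Real.logb 2 x) D)
  have hF : SlowlyVarying F := by
    refine SlowlyVarying.of_logb (h := fun u => min 1 (Metric.infDist u D)) (fun u => ?_)
      fun u v => ?_
    · rw [abs_of_nonneg (le_min zero_le_one Metric.infDist_nonneg)]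
      exact min_le_left _ _
    · refine (abs_min_sub_min_le_max _ _ _ _).trans ?_
      rw [sub_self, abs_zero]
      refine max_le (abs_nonneg _) ?_
      exact (Metric.lipschitz_infDist_pt D).dist_le_mul u v |>.trans_eq (by
        rw [NNReal.coe_one, one_mul, Real.dist_eq])
  have hval : ∀ (r : ℝ) (n : ℕ+), F ((2 : ℝ) ^ r * (2 : ℝ) ^ (n : ℕ))
      = min 1 (Metric.infDist ((n : ℕ) + r : ℝ) D) := fun r n => by
    simp only [F, logb_two_rpow_mul_two_pow]
  have h0 : limAt F (Quot.mk glue (η, s)) = 0 := by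
    refine tendsto_nhds_unique (hF.tendsto_limAt_mk hη s) (tendsto_const_nhds.congr' ?_)
    filter_upwards [hA] with n hn
    have : ((n : ℕ) + s : ℝ) ∈ D := ⟨n, hn, rfl⟩
    rw [hval, Metric.infDist_zero_of_mem this, min_eq_right zero_le_one]
  have h1 : min 1 δ ≤ limAt F (Quot.mk glue (ζ, t)) := by
    refine ge_of_tendsto (hF.tendsto_limAt_mk hζ t) ?_
    filter_upwards [hB] with n hn
    rw [hval]
    refine min_le_min le_rfl ((Metric.le_infDist hD).2 ?_)
    rintro _ ⟨m, hm, rfl⟩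
    exact h m hm n hn
  refine ⟨F, hF, ?_⟩
  rw [h0]
  exact (lt_of_lt_of_le (lt_min one_pos hδ) h1).ne

/-- Each point of `Ω*` has a representative `(η, t)` with `t < 1`. -/
theorem exists_rep_lt_one (ω : OmegaStar) : ∃ η ∈ freeUltrafilters, ∃ t : unitInterval,
    (t : ℝ) < 1 ∧ (ω : Omega) = Quot.mk glue (η, t) := by
  obtain ⟨_, η, hη, t, rfl⟩ := ω
  rcases lt_or_eq_of_le t.2.2 with ht | ht
  · exact ⟨η, hη, t, ht, rfl⟩
  · have ht' : t = 1 := Subtype.ext ht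
    exact ⟨shift η, shift_mem_freeUltrafilters_iff.2 hη, 0, by simp,
      Quot.sound ⟨ht', rfl, rfl⟩⟩

theorem exists_limAt_ne {ω ω' : OmegaStar} (h : ω ≠ ω') :
    ∃ F, SlowlyVarying F ∧ limAt F ω ≠ limAt F ω' := by
  obtain ⟨η, hη, s, hs, hω⟩ := exists_rep_lt_one ω
  obtain ⟨ζ, hζ, t, ht, hω'⟩ := exists_rep_lt_one ω'
  rw [hω, hω']
  have hs0 := s.2.1
  have ht0 := t.2.1
  by_cases hst : s = t
  · subst hst
    have hne : η ≠ ζ := fun hηζ => h (Subtype.ext (by rw [hω, hω', hηζ]))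
    obtain ⟨A, hA, hA'⟩ : ∃ A ∈ η, A ∉ ζ := by
      by_contra! hcon
      exact hne (Ultrafilter.coe_le_coe.1 fun A hA => hcon A hA).symm
    refine exists_slowlyVarying_limAt_ne hη hζ hA (Ultrafilter.compl_mem_iff_notMem.2 hA')
      one_pos fun m hm n hn => ?_
    have hmn : ((n : ℕ) : ℤ) - (m : ℕ) ≠ 0 := by
      intro h0
      have : n = m := PNat.eq (by omega)
      exact hn (this ▸ hm)
    have h1 := Int.one_le_abs hmn
    rw [add_sub_add_right_eq_sub]
    exact_mod_cast h1
  · have hst' : (s : ℝ) ≠ t := fun h0 => hst (Subtype.ext h0)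
    have hd : |(t : ℝ) - s| < 1 := abs_lt.2 ⟨by linarith, by linarith⟩
    have hd0 : 0 < |(t : ℝ) - s| := abs_pos.2 (sub_ne_zero.2 hst'.symm)
    refine exists_slowlyVarying_limAt_ne hη hζ univ_mem univ_mem
      (δ := min |(t : ℝ) - s| (1 - |(t : ℝ) - s|)) (lt_min hd0 (by linarith)) fun m _ n _ => ?_
    rw [add_sub_add_comm]
    by_cases hmn : n = m
    · subst hmn
      rw [sub_self, zero_add]
      exact min_le_left _ _
    · have hmn' : ((n : ℕ) : ℤ) - (m : ℕ) ≠ 0 := by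
        intro h0
        exact hmn (PNat.eq (by omega))
      have h1 : (1 : ℝ) ≤ |((n : ℕ) : ℝ) - (m : ℕ)| := by exact_mod_cast Int.one_le_abs hmn'
      have h2 := abs_sub_abs_le_abs_sub (((n : ℕ) : ℝ) - (m : ℕ)) (-((t : ℝ) - s))
      rw [abs_neg, sub_neg_eq_add] at h2
      exact (min_le_right _ _).trans (by linarith)

instance : T2Space OmegaStar := ⟨fun ω ω' h => by
  obtain ⟨F, hF, hne⟩ := exists_limAt_ne h
  exact separated_by_continuous hF.continuous_limAt hne⟩

/-- The limits of slowly varying functions, an algebra of continuous functions on `Ω*`. -/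
def limAlgebra : Subalgebra ℝ C(OmegaStar, ℝ) where
  carrier := {g | ∃ F, SlowlyVarying F ∧ ∀ ω : OmegaStar, g ω = limAt F ω}
  mul_mem' := by
    rintro g h ⟨F, hF, hg⟩ ⟨G, hG, hh⟩
    refine ⟨_, hF.mul hG, fun ω => ?_⟩
    rw [limAt_mul hF hG, ContinuousMap.mul_apply, hg, hh]
  add_mem' := by
    rintro g h ⟨F, hF, hg⟩ ⟨G, hG, hh⟩
    refine ⟨_, hF.add hG, fun ω => ?_⟩
    rw [limAt_add hF hG, ContinuousMap.add_apply, hg, hh]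
  algebraMap_mem' := fun c => ⟨_, SlowlyVarying.const c, fun ω => (limAt_const c ω).symm⟩

theorem dense_limAlgebra : Dense (limAlgebra : Set C(OmegaStar, ℝ)) := by
  have h := ContinuousMap.subalgebra_topologicalClosure_eq_top_of_separatesPoints limAlgebra
    fun ω ω' hne => by
      obtain ⟨F, hF, h⟩ := exists_limAt_ne hne
      exact ⟨_, ⟨⟨_, hF.continuous_limAt⟩, ⟨F, hF, fun _ => rfl⟩, rfl⟩, h⟩
  rw [dense_iff_closure_eq, ← Subalgebra.topologicalClosure_coe, h]
  rfl

end Separation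

/-! ### Upper limits as maxima over `Ω*` -/

section Limsup

variable {α : Type*} {l : Filter α} {u : α → ℝ} {C : ℝ}

theorem le_limsup_of_tendsto (hu : ∀ᶠ a in l, |u a| ≤ C) {V : Filter α} [V.NeBot] (hV : V ≤ l)
    {L : ℝ} (hL : Tendsto u V (𝓝 L)) : L ≤ limsup u l := by
  have hb : l.IsBoundedUnder (· ≤ ·) u := ⟨C, hu.mono fun a ha => (abs_le.1 ha).2⟩
  refine le_of_forall_gt_imp_ge_of_dense fun c hc => ?_
  exact le_of_tendsto hL (hV ((eventually_lt_of_limsup_lt hc hb).mono fun a ha => ha.le))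

theorem limsup_le_of_ultrafilter [l.NeBot] (hu : ∀ᶠ a in l, |u a| ≤ C) {c : ℝ}
    (h : ∀ U : Ultrafilter α, (U : Filter α) ≤ l → ∃ L ≤ c, Tendsto u U (𝓝 L)) :
    limsup u l ≤ c := by
  have hb : l.IsBoundedUnder (· ≥ ·) u := ⟨-C, hu.mono fun a ha => (abs_le.1 ha).1⟩
  by_contra! hc
  obtain ⟨c', hc', hc''⟩ := exists_between hc
  have hfreq := frequently_lt_of_lt_limsup hb.isCoboundedUnder_le hc''
  have hne : (l ⊓ 𝓟 {a | c' < u a}).NeBot := frequently_mem_iff_neBot.1 hfreq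
  let U := Ultrafilter.of (l ⊓ 𝓟 {a | c' < u a})
  have hU : (U : Filter α) ≤ l ⊓ 𝓟 {a | c' < u a} := Ultrafilter.of_le _
  obtain ⟨L, hL, hlim⟩ := h U (hU.trans inf_le_left)
  have h1 : ∀ᶠ a in (U : Filter α), c' < u a := le_principal_iff.1 (hU.trans inf_le_right)
  have h2 : c' ≤ L := ge_of_tendsto hlim (h1.mono fun a ha => ha.le)
  linarith

variable {F : ℝ → ℝ}

theorem SlowlyVarying.limsup_le_iff (hF : SlowlyVarying F) (c : ℝ) :
    limsup F atTop ≤ c ↔ ∀ ω : OmegaStar, limAt F ω ≤ c := by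
  obtain ⟨C, hC⟩ := hF.eventually_abs_le
  constructor
  · intro h ω
    obtain ⟨U, hU, hlim⟩ := exists_ultrafilter_tendsto_limAt ω
    exact (le_limsup_of_tendsto hC hU (hlim F hF)).trans h
  · intro h
    refine limsup_le_of_ultrafilter hC fun U hU => ?_
    obtain ⟨ω, hω⟩ := exists_tendsto_limAt_of_ultrafilter U hU
    exact ⟨_, h ω, hω F hF⟩

theorem tendsto_floor_div : Tendsto (fun x : ℝ => x / (⌊x⌋₊ : ℝ)) atTop (𝓝 1) := by
  have h := (tendsto_nat_floor_div_atTop (R := ℝ)).inv₀ one_ne_zero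
  rw [inv_one] at h
  exact h.congr fun x => inv_div _ _

theorem SlowlyVarying.tendsto_sub_floor (hF : SlowlyVarying F) :
    Tendsto (fun x : ℝ => F x - F ⌊x⌋₊) atTop (𝓝 0) :=
  hF.tendsto_sub (tendsto_natCast_atTop_atTop.comp tendsto_nat_floor_atTop) tendsto_floor_div

/-- The upper limit along the integers gives the same bound, as `F x - F ⌊x⌋ → 0`. -/
theorem SlowlyVarying.limsup_natCast_le_iff (hF : SlowlyVarying F) (c : ℝ) :
    limsup (fun n : ℕ => F n) atTop ≤ c ↔ ∀ ω : OmegaStar, limAt F ω ≤ c := by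
  obtain ⟨C, hC⟩ := hF.eventually_abs_le
  have hC' : ∀ᶠ n : ℕ in atTop, |F n| ≤ C := tendsto_natCast_atTop_atTop.eventually hC
  constructor
  · intro h ω
    obtain ⟨U, hU, hlim⟩ := exists_ultrafilter_tendsto_limAt ω
    have hfl : Tendsto (fun x : ℝ => ⌊x⌋₊) U atTop := tendsto_nat_floor_atTop.mono_left hU
    have h1 : Tendsto (fun x : ℝ => F ⌊x⌋₊) U (𝓝 (limAt F ω)) := by
      simpa using (hlim F hF).sub (hF.tendsto_sub_floor.mono_left hU)
    have h2 : Tendsto (fun n : ℕ => F n) (U.map fun x : ℝ => ⌊x⌋₊) (𝓝 (limAt F ω)) :=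
      tendsto_map'_iff.2 h1
    exact (le_limsup_of_tendsto hC' hfl h2).trans h
  · intro h
    refine limsup_le_of_ultrafilter hC' fun U hU => ?_
    obtain ⟨ω, hω⟩ := exists_tendsto_limAt_of_ultrafilter (U.map (Nat.cast : ℕ → ℝ))
      (tendsto_natCast_atTop_atTop.mono_left hU)
    exact ⟨_, h ω, tendsto_map'_iff.1 (hω F hF)⟩

end Limsup

/-! ### Operators into `C(Ω*)` given by means -/

section MeanOperator

variable {E : Type*} [NormedAddCommGroup E] [NormedSpace ℝ E]

/-- A linear family of slowly varying functions on `[1, ∞)` that is bounded by the norm. -/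
structure IsMeanFamily (M : E → ℝ → ℝ) : Prop where
  slowlyVarying : ∀ f, SlowlyVarying (M f)
  map_add : ∀ f g x, 1 ≤ x → M (f + g) x = M f x + M g x
  map_smul : ∀ (c : ℝ) f x, 1 ≤ x → M (c • f) x = c * M f x
  abs_le_norm : ∀ f x, 1 ≤ x → |M f x| ≤ ‖f‖

variable {M : E → ℝ → ℝ}

theorem limAt_congr {F G : ℝ → ℝ} (hF : SlowlyVarying F) (hG : SlowlyVarying G)
    (h : ∀ x, 1 ≤ x → F x = G x) (ω : OmegaStar) : limAt F ω = limAt G ω := by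
  refine limAt_eq_of_tendsto_sub hF hG (tendsto_const_nhds.congr' ?_) ω
  filter_upwards [eventually_ge_atTop 1] with x hx
  rw [h x hx, sub_self]

/-- The operator `f ↦ (ω ↦ limAt (M f) ω)` with values in `C(Ω*)`. -/
def limOperator (hM : IsMeanFamily M) : E →L[ℝ] C(OmegaStar, ℝ) :=
  LinearMap.mkContinuous
    { toFun := fun f => ⟨fun ω => limAt (M f) ω, (hM.slowlyVarying f).continuous_limAt⟩
      map_add' := fun f g => by
        ext ω
        have h := (hM.slowlyVarying f).add (hM.slowlyVarying g)
        exact (limAt_congr (hM.slowlyVarying _) h (hM.map_add f g) ω).trans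
          (limAt_add (hM.slowlyVarying f) (hM.slowlyVarying g) ω)
      map_smul' := fun c f => by
        ext ω
        have hc := SlowlyVarying.const c
        have h := hc.mul (hM.slowlyVarying f)
        refine (limAt_congr (hM.slowlyVarying _) h (hM.map_smul c f) ω).trans ?_
        rw [limAt_mul hc (hM.slowlyVarying f), limAt_const]
        rfl }
    1 fun f => by
      rw [one_mul, ContinuousMap.norm_le _ (norm_nonneg f)]
      intro ω
      obtain ⟨U, hU, hlim⟩ := exists_ultrafilter_tendsto_limAt ω
      refine le_of_tendsto (hlim _ (hM.slowlyVarying f)).abs (hU ?_)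
      filter_upwards [eventually_ge_atTop 1] with x hx using hM.abs_le_norm f x hx

@[simp]
theorem limOperator_apply (hM : IsMeanFamily M) (f : E) (ω : OmegaStar) :
    limOperator hM f ω = limAt (M f) ω := rfl

theorem denseRange_limOperator (hM : IsMeanFamily M)
    (h : ∀ F, SlowlyVarying F → ∃ f, Tendsto (fun x => M f x - F x) atTop (𝓝 0)) :
    DenseRange (limOperator hM) := by
  refine dense_limAlgebra.mono ?_
  rintro g ⟨F, hF, hg⟩
  obtain ⟨f, hf⟩ := h F hF
  refine ⟨f, ?_⟩
  ext ω
  rw [hg, limOperator_apply]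
  exact limAt_eq_of_tendsto_sub (hM.slowlyVarying f) hF hf ω

end MeanOperator

/-! ### Means of sequences -/

section SumMean

theorem abs_apply_le_norm (f : LInf) (i : ℕ+) : |f i| ≤ ‖f‖ :=
  lp.norm_apply_le_norm ENNReal.top_ne_zero f i

theorem abs_sum_range_sub_le (f : LInf) {m n : ℕ} (h : m ≤ n) :
    |∑ i ∈ Finset.range n, f i.succPNat - ∑ i ∈ Finset.range m, f i.succPNat|
      ≤ ‖f‖ * (n - m : ℝ) := by
  rw [← Finset.sum_Ico_eq_sub _ h]
  refine (Finset.abs_sum_le_sum_abs _ _).trans ?_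
  refine (Finset.sum_le_card_nsmul _ _ ‖f‖ fun i _ => abs_apply_le_norm f _).trans_eq ?_
  rw [Nat.card_Ico, nsmul_eq_mul, Nat.cast_sub h, mul_comm]

theorem abs_sum_range_floor_le (f : LInf) {x : ℝ} (hx : 1 ≤ x) :
    |∑ i ∈ Finset.range ⌊x⌋₊, f i.succPNat| ≤ ‖f‖ * x := by
  have h := abs_sum_range_sub_le f (Nat.zero_le ⌊x⌋₊)
  simp only [Finset.range_zero, Finset.sum_empty, sub_zero, Nat.cast_zero] at h
  exact h.trans (mul_le_mul_of_nonneg_left (Nat.floor_le (by linarith)) (norm_nonneg f))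

theorem isMeanFamily_sumMean : IsMeanFamily sumMean where
  slowlyVarying f := by
    refine SlowlyVarying.of_div (norm_nonneg f) (fun x hx => abs_sum_range_floor_le f hx)
      fun x y hx hxy => ?_
    refine (abs_sum_range_sub_le f (Nat.floor_le_floor hxy)).trans ?_
    refine mul_le_mul_of_nonneg_left ?_ (norm_nonneg f)
    have h1 := Nat.floor_le (by linarith : 0 ≤ y)
    have h2 := Nat.lt_floor_add_one x
    linarith
  map_add f g x _ := by
    simp only [sumMean, lp.coeFn_add, Pi.add_apply, Finset.sum_add_distrib, mul_add]
  map_smul c f x _ := by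
    simp only [sumMean, lp.coeFn_smul, Pi.smul_apply, smul_eq_mul, ← Finset.mul_sum]
    ring
  abs_le_norm f x hx := by
    have hx0 : 0 < x := by linarith
    rw [sumMean, abs_mul, abs_of_pos (one_div_pos.2 hx0), one_div, inv_mul_le_iff₀ hx0, mul_comm]
    exact abs_sum_range_floor_le f hx

/-- The sequence `f(n) = n F(n) - (n - 1) F(n - 1)` has the means `F(n)`. -/
theorem exists_tendsto_sumMean_sub {F : ℝ → ℝ} (hF : SlowlyVarying F) :
    ∃ f : LInf, Tendsto (fun x => sumMean f x - F x) atTop (𝓝 0) := by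
  obtain ⟨C, hC, h1, h2⟩ := id hF
  let a : ℕ+ → ℝ := fun n => (n : ℕ) * F (n : ℕ) - (n.natPred : ℕ) * F (n.natPred : ℕ)
  have ha : ∀ m : ℕ, a m.succPNat = (m + 1 : ℕ) * F (m + 1 : ℕ) - m * F m := fun m => by
    simp only [a, Nat.succPNat_coe, Nat.natPred_succPNat, Nat.succ_eq_add_one]
  have hbound : ∀ m : ℕ, |a m.succPNat| ≤ 3 * C := fun m => by
    rw [ha]
    rcases Nat.eq_zero_or_pos m with rfl | hm
    · have := h1 1 le_rfl
      simp only [zero_add, Nat.cast_one, one_mul, Nat.cast_zero, zero_mul, sub_zero]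
      linarith
    · have hm1 : (1 : ℝ) ≤ m := by exact_mod_cast hm
      have h3 : ((m + 1 : ℕ) : ℝ) * F (m + 1 : ℕ) - m * F m
          = (F (m + 1) - F m) * (m + 1) + F m := by
        push_cast
        ring
      have h4 := h2 m (m + 1) hm1 (by linarith)
      rw [h3]
      refine (abs_add_le _ _).trans ?_
      rw [abs_mul, abs_of_pos (by positivity : (0 : ℝ) < m + 1)]
      linarith [h1 m hm1]
  have hmem : Memℓp a ∞ := memℓp_infty ⟨3 * C, by
    rintro _ ⟨n, rfl⟩
    have := hbound n.natPred
    rwa [PNat.succPNat_natPred] at this⟩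
  let f : LInf := ⟨a, hmem⟩
  have hsum : ∀ N : ℕ, ∑ i ∈ Finset.range N, f i.succPNat = N * F N := fun N => by
    have h3 := Finset.sum_range_sub (fun n : ℕ => (n : ℝ) * F n) N
    rw [Nat.cast_zero, zero_mul, sub_zero] at h3
    rw [← h3]
    exact Finset.sum_congr rfl fun i _ => ha i
  refine ⟨f, ?_⟩
  have h3 : Tendsto (fun x : ℝ => ((⌊x⌋₊ : ℝ) / x - 1) * F ⌊x⌋₊) atTop (𝓝 0) := by
    have h4 : Tendsto (fun x : ℝ => |(⌊x⌋₊ : ℝ) / x - 1| * C) atTop (𝓝 0) := by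
      simpa using ((tendsto_nat_floor_div_atTop (R := ℝ)).sub_const 1).abs.mul_const C
    refine squeeze_zero_norm' ?_ h4
    filter_upwards [eventually_ge_atTop 1] with x hx
    rw [norm_mul, Real.norm_eq_abs, Real.norm_eq_abs]
    refine mul_le_mul_of_nonneg_left (h1 _ ?_) (abs_nonneg _)
    exact_mod_cast Nat.le_floor (by simpa using hx)
  have h4 := h3.sub hF.tendsto_sub_floor
  rw [sub_zero] at h4
  refine h4.congr fun x => ?_
  simp only [sumMean, hsum]
  ring

end SumMean

/-! ### Means of functions on `[1, ∞)` -/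

section IntMean

theorem ae_abs_le_norm (f : LInfR) : ∀ᵐ t, 1 ≤ t → |f t| ≤ ‖f‖ := by
  have h : ∀ᵐ t ∂(volume.restrict (Ici (1 : ℝ))), |f t| ≤ ‖f‖ := by
    filter_upwards [ae_le_eLpNormEssSup (f := f) (μ := volume.restrict (Ici (1 : ℝ)))] with t ht
    rw [← eLpNorm_exponent_top] at ht
    have := ENNReal.toReal_mono (Lp.eLpNorm_ne_top f) ht
    rwa [toReal_enorm, ← Lp.norm_def, Real.norm_eq_abs] at this
  exact (ae_restrict_iff' measurableSet_Ici).1 h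

theorem intervalIntegrable_coe (f : LInfR) {a b : ℝ} (ha : 1 ≤ a) (hab : a ≤ b) :
    IntervalIntegrable f volume a b := by
  rw [intervalIntegrable_iff_integrableOn_Ioc_of_le hab]
  have hsub : Ioc a b ⊆ Ici (1 : ℝ) := fun t ht => ha.trans ht.1.le
  exact ((Lp.memLp f).mono_measure (Measure.restrict_mono hsub le_rfl)).integrable le_top

theorem abs_integral_le_norm (f : LInfR) {a b : ℝ} (ha : 1 ≤ a) (hab : a ≤ b) :
    |∫ t in a..b, f t| ≤ ‖f‖ * (b - a) := by
  rw [← abs_of_nonneg (sub_nonneg.2 hab)]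
  refine intervalIntegral.norm_integral_le_of_norm_le_const_ae (E := ℝ) ?_
  filter_upwards [ae_abs_le_norm f] with t ht hmem
  rw [uIoc_of_le hab] at hmem
  exact ht (ha.trans hmem.1.le)

/-- On `[1, ∞)` an integral depends only on the almost everywhere class. -/
theorem integral_congr_of_ae_restrict {f g : ℝ → ℝ} (h : f =ᵐ[volume.restrict (Ici (1 : ℝ))] g)
    {a b : ℝ} (ha : 1 ≤ a) (hab : a ≤ b) : ∫ t in a..b, f t = ∫ t in a..b, g t := by
  refine intervalIntegral.integral_congr_ae ?_
  filter_upwards [(ae_restrict_iff' measurableSet_Ici).1 h] with t ht hmem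
  rw [uIoc_of_le hab] at hmem
  exact ht (ha.trans hmem.1.le)

theorem isMeanFamily_intMean : IsMeanFamily intMean where
  slowlyVarying f := by
    refine SlowlyVarying.of_div (norm_nonneg f) (fun x hx => ?_) fun x y hx hxy => ?_
    · exact (abs_integral_le_norm f le_rfl hx).trans
        (mul_le_mul_of_nonneg_left (by linarith) (norm_nonneg f))
    · rw [intervalIntegral.integral_interval_sub_left (intervalIntegrable_coe f le_rfl
        (hx.trans hxy)) (intervalIntegrable_coe f le_rfl hx)]
      exact (abs_integral_le_norm f hx hxy).trans
        (mul_le_mul_of_nonneg_left (by linarith) (norm_nonneg f))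
  map_add f g x hx := by
    rw [intMean, integral_congr_of_ae_restrict (Lp.coeFn_add f g) le_rfl hx]
    simp only [Pi.add_apply]
    rw [intervalIntegral.integral_add (intervalIntegrable_coe f le_rfl hx)
      (intervalIntegrable_coe g le_rfl hx), mul_add]
    rfl
  map_smul c f x hx := by
    rw [intMean, integral_congr_of_ae_restrict (Lp.coeFn_smul c f) le_rfl hx]
    simp only [Pi.smul_apply, smul_eq_mul]
    rw [intervalIntegral.integral_const_mul, mul_left_comm]
    rfl
  abs_le_norm f x hx := by
    have hx0 : 0 < x := by linarith
    rw [intMean, abs_mul, abs_of_pos (one_div_pos.2 hx0), one_div, inv_mul_le_iff₀ hx0, mul_comm]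
    exact (abs_integral_le_norm f le_rfl hx).trans
      (mul_le_mul_of_nonneg_left (by linarith) (norm_nonneg f))

/-- The step function with the value `f(n)` on `(n - 1, n]`. -/
def stepFun (f : LInf) (t : ℝ) : ℝ := f ⌈t⌉₊.toPNat'

theorem memLp_stepFun (f : LInf) : MemLp (stepFun f) ∞ (volume.restrict (Ici (1 : ℝ))) := by
  have hmeas : Measurable (stepFun f) :=
    (measurable_from_nat (f := fun n : ℕ => f n.toPNat')).comp Nat.measurable_ceil
  exact memLp_top_of_bound hmeas.aestronglyMeasurable ‖f‖
    (ae_of_all _ fun t => abs_apply_le_norm f _)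

theorem integral_stepFun_natCast_succ (f : LInf) (n : ℕ) :
    ∫ t in (n : ℝ)..(n + 1 : ℕ), stepFun f t = f n.succPNat := by
  have h : ∀ t ∈ uIoc (n : ℝ) (n + 1 : ℕ), stepFun f t = f n.succPNat := fun t ht => by
    rw [uIoc_of_le (by push_cast; linarith)] at ht
    have hc : ⌈t⌉₊ = n + 1 := (Nat.ceil_eq_iff n.succ_ne_zero).2 ⟨ht.1, ht.2⟩
    rw [stepFun, hc]
    rfl
  rw [intervalIntegral.integral_congr_ae (ae_of_all _ h), intervalIntegral.integral_const]
  simp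

/-- The integral means of the step function of `f` are asymptotic to the means of `f`. -/
theorem tendsto_intMean_stepFun_sub (f : LInf) :
    Tendsto (fun x => intMean (memLp_stepFun f).toLp x - sumMean f x) atTop (𝓝 0) := by
  set g : LInfR := (memLp_stepFun f).toLp with hg
  have hae : (g : ℝ → ℝ) =ᵐ[volume.restrict (Ici (1 : ℝ))] stepFun f :=
    (memLp_stepFun f).coeFn_toLp
  have hnat : ∀ N : ℕ, 1 ≤ N →
      ∫ t in (1 : ℝ)..N, g t = ∑ i ∈ Finset.range N, f i.succPNat - f 1 := by
    intro N hN
    induction N, hN using Nat.le_induction with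
    | base =>
      rw [Nat.cast_one, intervalIntegral.integral_same, Finset.sum_range_one]
      exact (sub_self (f 1)).symm
    | succ N hN ih =>
      have hN' : (1 : ℝ) ≤ N := by exact_mod_cast hN
      have hN'' : (N : ℝ) ≤ (N + 1 : ℕ) := by push_cast; linarith
      rw [← intervalIntegral.integral_add_adjacent_intervals (intervalIntegrable_coe g le_rfl hN')
        (intervalIntegrable_coe g hN' hN''), ih, integral_congr_of_ae_restrict hae hN' hN'',
        integral_stepFun_natCast_succ, Finset.sum_range_succ]
      ring
  have hbound : ∀ x : ℝ, 1 ≤ x → ‖intMean g x - sumMean f x‖ ≤ (‖g‖ + ‖f‖) / x := by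
    intro x hx
    have hx0 : 0 < x := by linarith
    have hN : 1 ≤ ⌊x⌋₊ := Nat.le_floor (by simpa using hx)
    have hN' : (1 : ℝ) ≤ ⌊x⌋₊ := by exact_mod_cast hN
    have hfl := Nat.floor_le hx0.le
    have h1 : intMean g x - sumMean f x = ((∫ t in (⌊x⌋₊ : ℝ)..x, g t) - f 1) / x := by
      rw [intMean, sumMean, ← intervalIntegral.integral_add_adjacent_intervals
        (intervalIntegrable_coe g le_rfl hN') (intervalIntegrable_coe g hN' hfl), hnat _ hN]
      ring
    rw [h1, norm_div, Real.norm_eq_abs x, abs_of_pos hx0]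
    refine div_le_div_of_nonneg_right ((norm_sub_le _ _).trans (add_le_add ?_ ?_)) hx0.le
    · refine (abs_integral_le_norm g hN' hfl).trans ?_
      have := Nat.lt_floor_add_one x
      nlinarith [norm_nonneg g]
    · exact abs_apply_le_norm f 1
  refine squeeze_zero_norm' ?_ (tendsto_id.const_div_atTop (‖g‖ + ‖f‖))
  filter_upwards [eventually_ge_atTop 1] with x hx using hbound x hx

theorem exists_tendsto_intMean_sub {F : ℝ → ℝ} (hF : SlowlyVarying F) :
    ∃ f : LInfR, Tendsto (fun x => intMean f x - F x) atTop (𝓝 0) := by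
  obtain ⟨f, hf⟩ := exists_tendsto_sumMean_sub hF
  refine ⟨(memLp_stepFun f).toLp, ?_⟩
  simpa using (tendsto_intMean_stepFun_sub f).add hf

end IntMean

end CesaroBauer

end

open CesaroBauer in
theorem corollary4p3 :
    -- the integrands are continuous, so that all integrals below are genuine
    (∀ f : LInf, Continuous fun ω : OmegaStar => phi ω f) ∧
    (∀ f : LInfR, Continuous fun ω : OmegaStar => psi ω f) ∧
    -- unique integral representation of the elements of `𝒞`
    (∀ φ : LInf →ₗ[ℝ] ℝ, IsCesaroFunctional φ →
      ∃! μ : RegProb OmegaStar, ∀ f : LInf, φ f = ∫ ω, phi ω f ∂μ.meas) ∧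
    -- unique integral representation of the elements of `ℳ`
    (∀ ψ : LInfR →ₗ[ℝ] ℝ, IsMeanFunctional ψ →
      ∃! μ : RegProb OmegaStar, ∀ f : LInfR, ψ f = ∫ ω, psi ω f ∂μ.meas) ∧
    -- `μ ↦ (f ↦ ∫ φ_ω(f) dμ(ω))` is an affine homeomorphism of `P(Ω*)` onto `𝒞`
    (∃ e : RegProb OmegaStar ≃ₜ classC,
      (∀ (μ : RegProb OmegaStar) (f : LInf),
        (e μ : WeakDual ℝ LInf) f = ∫ ω, phi ω f ∂μ.meas) ∧
      ∀ (a b : ℝ≥0) (h : a + b = 1) (μ ν : RegProb OmegaStar),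
        (e (RegProb.mix a b h μ ν) : WeakDual ℝ LInf) =
          (a : ℝ) • (e μ : WeakDual ℝ LInf) + (b : ℝ) • (e ν : WeakDual ℝ LInf)) ∧
    -- `μ ↦ (f ↦ ∫ ψ_ω(f) dμ(ω))` is an affine homeomorphism of `P(Ω*)` onto `ℳ`
    (∃ e : RegProb OmegaStar ≃ₜ classM,
      (∀ (μ : RegProb OmegaStar) (f : LInfR),
        (e μ : WeakDual ℝ LInfR) f = ∫ ω, psi ω f ∂μ.meas) ∧
      ∀ (a b : ℝ≥0) (h : a + b = 1) (μ ν : RegProb OmegaStar),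
        (e (RegProb.mix a b h μ ν) : WeakDual ℝ LInfR) =
          (a : ℝ) • (e μ : WeakDual ℝ LInfR) + (b : ℝ) • (e ν : WeakDual ℝ LInfR)) ∧
    -- `𝒞` is a Bauer simplex
    IsBauerSimplex classC := by
  have hS := denseRange_limOperator isMeanFamily_sumMean fun F hF => exists_tendsto_sumMean_sub hF
  have hI := denseRange_limOperator isMeanFamily_intMean fun F hF => exists_tendsto_intMean_sub hF
  have hpS : ∀ (f : LInf) (c : ℝ), upperCesaro f ≤ c ↔
      ∀ ω, limOperator isMeanFamily_sumMean f ω ≤ c := fun f =>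
    (isMeanFamily_sumMean.slowlyVarying f).limsup_natCast_le_iff
  have hpI : ∀ (f : LInfR) (c : ℝ), upperMean f ≤ c ↔
      ∀ ω, limOperator isMeanFamily_intMean f ω ≤ c := fun f =>
    (isMeanFamily_intMean.slowlyVarying f).limsup_le_iff
  exact ⟨fun f => (isMeanFamily_sumMean.slowlyVarying f).continuous_limAt,
    fun f => (isMeanFamily_intMean.slowlyVarying f).continuous_limAt,
    existsUnique_regProb hS hpS, existsUnique_regProb hI hpI,
    ⟨homeoDominated hS hpS, fun _ _ => rfl, homeoDominated_mix hS hpS⟩,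
    ⟨homeoDominated hI hpI, fun _ _ => rfl, homeoDominated_mix hI hpI⟩,
    isBauerSimplex_dominated hS hpS⟩
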